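/- Let $a>0$ and $b\ge 1$, and put $a_{cr}=(b^2-1)^{-1}$, with $a_{cr}=+\infty$ if $b=1$. Let $$V(x)=\frac{1+a}{2}\log\left(x^2+b^{-2}\right)-\frac a2\log\left(x^2+b^2\right),\qquad x\in\mathbb R.$$ This external field is weakly admissible: it is lower semicontinuous and $V(x)-\frac12\log(1+x^2)$ has a finite limit as $|x|\to\infty$. For a Borel probability measure $\mu$ on $\mathbb R$ let $$I_V[\mu]=\iint_{\mathbb R\times\mathbb R}\left(\log\frac1{|x-y|}+V(x)+V(y)\right)d\mu(x)\,d\mu(y)\in(-\infty,+\infty]$$ (with $\log\frac10=+\infty$), which equals $\iint\log\frac1{|x-y|}\,d\mu(x)\,d\mu(y)+2\int V\,d\mu$ whenever both of these integrals converge absolutely. Then there is a unique minimizer $\mu_V$ of $I_V$ among all Borel probability measures on $\mathbb R$ (the equilibrium measure in the external field $V$), and it is described as follows. (i) If $a\le a_{cr}$, then $\mu_V$ has support $\mathbb R$ and is absolutely continuous with the nonnegative density $$\frac{d\mu_V}{dx}=\frac{(1+a-b^2a)x^2+b^2+b^2a-a}{\pi b\,(x^2+b^2)(x^2+b^{-2})},\qquad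 x\in\mathbb R.$$ (ii) If $a>a_{cr}$, then $\mu_V$ has support $[-A,A]$ and is absolutely continuous with density $$\frac{d\mu_V}{dx}=\frac{\sqrt C\,\sqrt{A^2-x^2}}{\pi(x^2+b^2)(x^2+b^{-2})},\qquad x\in[-A,A],$$ where $$A=\frac{b\sqrt{1+2a}}{\sqrt{b^2a+a+1}\,\sqrt{b^2a-a-1}}>0,\qquad C=\frac{(b^4-1)(b^2a+a+1)(b^2a-a-1)}{b^4}>0.$$ -/

import Mathlib

open MeasureTheory Set Filter Topology

noncomputable section

namespace TwoCharges

/-- An external field on the line is weakly admissible: it is lower semicontinuous and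
`V x - log (1 + x ^ 2) / 2` has a finite limit as `|x| → ∞`. -/
def IsWeaklyAdmissible (V : ℝ → ℝ) : Prop :=
  LowerSemicontinuous V ∧
    ∃ l : ℝ, Tendsto (fun x => V x - (1 / 2) * Real.log (1 + x ^ 2)) (cocompact ℝ) (𝓝 l)

/-- The weighted logarithmic kernel `log (1 / |x - y|) + V x + V y`, equal to `+∞` on the
diagonal. -/
def weightedKernel (V : ℝ → ℝ) (x y : ℝ) : EReal :=
  if x = y then ⊤ else ((Real.log (1 / |x - y|) + V x + V y : ℝ) : EReal)

/-- The weighted logarithmic energy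
`I_V[μ] = ∬ log (1 / |x - y|) dμ(x) dμ(y) + 2 ∫ V dμ` of a probability measure, with values in
the extended reals. As usual for weakly admissible fields the two terms are combined under one
double integral (positive part minus negative part): the combined kernel is bounded below for
such fields, so the energy is defined in `(-∞, +∞]` for every probability measure, while the
separate terms can be `-∞` and `+∞` when `μ` has heavy tails. -/
def weightedEnergy (V : ℝ → ℝ) (μ : Measure ℝ) : EReal :=
  ((∫⁻ p : ℝ × ℝ, (weightedKernel V p.1 p.2).toENNReal ∂(μ.prod μ) : ENNReal) : EReal) -
    ((∫⁻ p : ℝ × ℝ, (-weightedKernel V p.1 p.2).toENNReal ∂(μ.prod μ) : ENNReal) : EReal)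

/-- For a measure without atoms (any atom gives infinite logarithmic energy), whenever the two
terms are separately integrable, the energy is the usual sum. -/
theorem weightedEnergy_eq (V : ℝ → ℝ) (μ : Measure ℝ) [IsProbabilityMeasure μ] [NullSingletonClass μ]
    (hlog : Integrable (fun p : ℝ × ℝ => Real.log (1 / |p.1 - p.2|)) (μ.prod μ))
    (hV : Integrable V μ) :
    weightedEnergy V μ =
      (((∫ p : ℝ × ℝ, Real.log (1 / |p.1 - p.2|) ∂(μ.prod μ)) + 2 * ∫ x, V x ∂μ : ℝ) :
        EReal) := by
  have hV1 : Integrable (fun p : ℝ × ℝ => V p.1) (μ.prod μ) := hV.comp_fst μ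
  have hV2 : Integrable (fun p : ℝ × ℝ => V p.2) (μ.prod μ) := hV.comp_snd μ
  have hk : Integrable (fun p : ℝ × ℝ => Real.log (1 / |p.1 - p.2|) + V p.1 + V p.2)
      (μ.prod μ) := (hlog.add hV1).add hV2
  have hlV : Integrable (fun p : ℝ × ℝ => Real.log (1 / |p.1 - p.2|) + V p.1) (μ.prod μ) :=
    hlog.add hV1
  have hn : Integrable (fun p : ℝ × ℝ => -(Real.log (1 / |p.1 - p.2|) + V p.1 + V p.2))
      (μ.prod μ) := hk.neg
  have hd : ∀ᵐ p : ℝ × ℝ ∂(μ.prod μ), p.1 ≠ p.2 := by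
    have hm : MeasurableSet {p : ℝ × ℝ | p.1 ≠ p.2} :=
      (measurableSet_eq_fun measurable_fst measurable_snd).compl
    rw [Measure.ae_prod_iff_ae_ae hm]
    refine Eventually.of_forall fun x => ?_
    have : ∀ᵐ y ∂μ, y ≠ x := by simp [ae_iff]
    filter_upwards [this] with y hy using hy.symm
  have e1 : ∫⁻ p : ℝ × ℝ, (weightedKernel V p.1 p.2).toENNReal ∂(μ.prod μ) =
      ∫⁻ p : ℝ × ℝ, ENNReal.ofReal (Real.log (1 / |p.1 - p.2|) + V p.1 + V p.2)
        ∂(μ.prod μ) := by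
    refine lintegral_congr_ae ?_
    filter_upwards [hd] with p hp
    rw [weightedKernel, if_neg hp, EReal.real_coe_toENNReal]
  have e2 : ∫⁻ p : ℝ × ℝ, (-weightedKernel V p.1 p.2).toENNReal ∂(μ.prod μ) =
      ∫⁻ p : ℝ × ℝ, ENNReal.ofReal (-(Real.log (1 / |p.1 - p.2|) + V p.1 + V p.2))
        ∂(μ.prod μ) := by
    refine lintegral_congr_ae ?_
    filter_upwards [hd] with p hp
    rw [weightedKernel, if_neg hp, ← EReal.coe_neg, EReal.real_coe_toENNReal]
  have hs : ∫ p : ℝ × ℝ, (Real.log (1 / |p.1 - p.2|) + V p.1 + V p.2) ∂(μ.prod μ) =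
      (∫ p : ℝ × ℝ, Real.log (1 / |p.1 - p.2|) ∂(μ.prod μ)) + 2 * ∫ x, V x ∂μ := by
    rw [integral_add hlV hV2, integral_add hlog hV1, integral_fun_fst,
      integral_fun_snd]
    simp
    ring
  rw [← hs, integral_eq_lintegral_pos_part_sub_lintegral_neg_part hk, weightedEnergy, e1, e2,
    EReal.coe_sub, EReal.coe_ennreal_toReal hk.lintegral_lt_top.ne,
    EReal.coe_ennreal_toReal hn.lintegral_lt_top.ne]

/-- `μ` minimizes the weighted logarithmic energy among all Borel probability measures on the
line. -/
def IsEnergyMinimizer (V : ℝ → ℝ) (μ : Measure ℝ) : Prop :=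
  IsProbabilityMeasure μ ∧
    ∀ ν : Measure ℝ, IsProbabilityMeasure ν → weightedEnergy V μ ≤ weightedEnergy V ν

/-- `μ` is the equilibrium measure in the external field `V`: the unique minimizer of the
weighted logarithmic energy among all probability measures on the line. -/
def IsEquilibriumMeasure (V : ℝ → ℝ) (μ : Measure ℝ) : Prop :=
  IsEnergyMinimizer V μ ∧ ∀ ν : Measure ℝ, IsEnergyMinimizer V ν → ν = μ

/-- The external field `V`. -/
def field (a b x : ℝ) : ℝ :=
  (1 + a) / 2 * Real.log (x ^ 2 + (b ^ 2)⁻¹) - a / 2 * Real.log (x ^ 2 + b ^ 2)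

/-- The critical charge `(b ^ 2 - 1)⁻¹` for `b > 1`, read as `+∞` for `b = 1`. -/
def criticalCharge (b : ℝ) : EReal :=
  if b = 1 then ⊤ else (((b ^ 2 - 1)⁻¹ : ℝ) : EReal)

/-- The density in the case `a ≤ criticalCharge b`. -/
def subcriticalDensity (a b x : ℝ) : ℝ :=
  ((1 + a - b ^ 2 * a) * x ^ 2 + b ^ 2 + b ^ 2 * a - a) /
    (Real.pi * b * (x ^ 2 + b ^ 2) * (x ^ 2 + (b ^ 2)⁻¹))

/-- The endpoint `A` of the support in the case `a > criticalCharge b`. -/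
def endpointA (a b : ℝ) : ℝ :=
  b * √(1 + 2 * a) / (√(b ^ 2 * a + a + 1) * √(b ^ 2 * a - a - 1))

/-- The constant `C` in the case `a > criticalCharge b`. -/
def constantC (a b : ℝ) : ℝ :=
  (b ^ 4 - 1) * (b ^ 2 * a + a + 1) * (b ^ 2 * a - a - 1) / b ^ 4

/-- The density on `[-A, A]` in the case `a > criticalCharge b`. -/
def supercriticalDensity (a b x : ℝ) : ℝ :=
  √(constantC a b) * √(endpointA a b ^ 2 - x ^ 2) /
    (Real.pi * (x ^ 2 + b ^ 2) * (x ^ 2 + (b ^ 2)⁻¹))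

end TwoCharges

end

/-!
The field `V` is the potential of the charges `-(1 + a)` at `i / b` and `a` at `i b`, and its
equilibrium measure is obtained by sweeping the opposite charges onto the line, or onto an interval
when sweeping onto the line gives a signed measure.

*Reduction to Euler–Lagrange conditions.* Write `V = log (1 + x²) / 2 + h` with `h` bounded. The
weighted kernel becomes `k(x, y) + h(x) + h(y)`, where `k` is the logarithmic kernel of the chordal
distance between the images of `x` and `y` under the Cayley transform; it is nonnegative, which
avoids all questions of integrability at infinity. Expanding `-log |1 - r z w̄|` in powers of `r`
and letting `r → 1` shows that `k` is positive definite on differences of probability measures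
(`sq_norm_circleMoment_sub_le`), strictly so because trigonometric moments determine a measure
(`eq_of_circleMoment_eq`). Hence a measure with bounded potential that satisfies the
Euler–Lagrange conditions is the unique minimizer (`isEquilibriumMeasure_of_eulerLagrange`).

*Potentials.* All integrals reduce to `∫ log |w - z| dw / (π (1 + w²)) = log |z + i|` for
`Im z ≥ 0` (`integral_log_norm_sub`), which is the circle average of `log |· - a|` seen through the
Cayley transform. By scaling, the Cauchy density of scale `c` has the same potential on the line as
a unit charge at `i c`; this settles the subcritical case. In the supercritical case the map
`w ↦ A k w / √(1 + k² w²)` with `k = c / √(A² + c²)` carries the Cauchy distribution to the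
balayage onto `[-A, A]` of a unit charge at `i c`, and the potential of the balayage differs from
that of the charge by a constant and the term `artanh (k √(x² - A²) / |x|)`, present only outside
`[-A, A]` (`integral_balayageDensity_log`). The endpoint `A` is determined by
`(1 + a) k₁ = a k₂` (`aspectRatio_balance`), which cancels the singularities of the two densities
at `±A` and makes the two inverse hyperbolic tangents comparable term by term
(`mul_log_div_le_mul_log_div`).
-/

noncomputable section

namespace TwoCharges

/-! ### Positive definiteness of the chordal kernel -/

open scoped ComplexConjugate

/-- The Cayley transform `x ↦ (1 + i x) / (1 - i x)` from the line to the unit circle. -/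
def cayley (x : ℝ) : ℂ := (1 + x * Complex.I) / (1 - x * Complex.I)

/-- The kernel `log (√(1 + x²) √(1 + y²) / |x - y|)`, that is, the logarithmic kernel of the
chordal distance transported from the circle to the line. On the diagonal `Real.log 0 = 0` gives
it the finite value `log (1 + x²)` instead of `+∞`. -/
def chordalKernel (x y : ℝ) : ℝ :=
  1 / 2 * Real.log (1 + x ^ 2) + 1 / 2 * Real.log (1 + y ^ 2) - Real.log |x - y|

/-- The kernel `- log |1 - r z w̄|` for `z`, `w` the Cayley transforms of `x`, `y`: the
Abel regularization of the chordal kernel. -/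
def abelKernel (r x y : ℝ) : ℝ := -Real.log ‖1 - r * (cayley x * conj (cayley y))‖

lemma one_sub_mul_I_ne_zero (x : ℝ) : (1 - x * Complex.I : ℂ) ≠ 0 := by
  intro h
  have := congrArg Complex.re h
  simp at this

lemma norm_one_sub_mul_I (x : ℝ) : ‖(1 - x * Complex.I : ℂ)‖ = √(1 + x ^ 2) := by
  rw [Complex.norm_eq_sqrt_sq_add_sq]
  simp

lemma norm_one_add_mul_I (x : ℝ) : ‖(1 + x * Complex.I : ℂ)‖ = √(1 + x ^ 2) := by
  rw [Complex.norm_eq_sqrt_sq_add_sq]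
  simp

lemma norm_cayley (x : ℝ) : ‖cayley x‖ = 1 := by
  rw [cayley, norm_div, norm_one_sub_mul_I, norm_one_add_mul_I]
  exact div_self (by positivity)

lemma continuous_cayley : Continuous cayley := by
  unfold cayley
  exact Continuous.div (by fun_prop) (by fun_prop) one_sub_mul_I_ne_zero

lemma cayley_mul_conj (x : ℝ) : cayley x * conj (cayley x) = 1 := by
  rw [Complex.mul_conj, Complex.normSq_eq_norm_sq, norm_cayley]
  simp

lemma cayley_sub_cayley (x y : ℝ) : cayley x - cayley y =
    2 * Complex.I * ((x - y : ℝ) : ℂ) / ((1 - x * Complex.I) * (1 - y * Complex.I)) := by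
  rw [cayley, cayley]
  have hx := one_sub_mul_I_ne_zero x
  have hy := one_sub_mul_I_ne_zero y
  rw [div_sub_div _ _ hx hy]
  push_cast
  ring

lemma cayley_injective : Function.Injective cayley := by
  intro x y h
  have h1 := cayley_sub_cayley x y
  rw [h, sub_self, eq_comm, div_eq_zero_iff] at h1
  rcases h1 with h1 | h1
  · have : ((x - y : ℝ) : ℂ) = 0 := by simpa using h1
    rw [Complex.ofReal_eq_zero] at this
    linarith
  · exact absurd h1 (mul_ne_zero (one_sub_mul_I_ne_zero x) (one_sub_mul_I_ne_zero y))

lemma norm_one_sub_cayley_mul_conj (x y : ℝ) :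
    ‖1 - cayley x * conj (cayley y)‖ = 2 * |x - y| / (√(1 + x ^ 2) * √(1 + y ^ 2)) := by
  have h : 1 - cayley x * conj (cayley y) = (cayley y - cayley x) * conj (cayley y) := by
    rw [sub_mul, cayley_mul_conj]
  rw [h, norm_mul, RCLike.norm_conj, norm_cayley, mul_one, norm_sub_rev, cayley_sub_cayley,
    norm_div, norm_mul, norm_mul, norm_mul, norm_one_sub_mul_I, norm_one_sub_mul_I,
    Complex.norm_real, Real.norm_eq_abs]
  simp

lemma chordalKernel_eq {x y : ℝ} (hxy : x ≠ y) :
    chordalKernel x y = Real.log 2 - Real.log ‖1 - cayley x * conj (cayley y)‖ := by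
  have h : |x - y| ≠ 0 := by simpa [sub_eq_zero] using hxy
  rw [norm_one_sub_cayley_mul_conj, Real.log_div (by positivity) (by positivity),
    Real.log_mul (by norm_num) h, Real.log_mul (by positivity) (by positivity),
    Real.log_sqrt (by positivity), Real.log_sqrt (by positivity), chordalKernel]
  ring

lemma chordalKernel_nonneg (x y : ℝ) : 0 ≤ chordalKernel x y := by
  rcases eq_or_ne x y with rfl | h
  · have : 0 ≤ Real.log (1 + x ^ 2) := Real.log_nonneg (by nlinarith [sq_nonneg x])
    simp only [chordalKernel, sub_self, abs_zero, Real.log_zero]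
    linarith
  · rw [chordalKernel_eq h, sub_nonneg]
    have hn : ‖1 - cayley x * conj (cayley y)‖ ≤ 2 := by
      refine (norm_sub_le _ _).trans ?_
      rw [norm_mul, RCLike.norm_conj, norm_cayley, norm_cayley]
      norm_num
    refine Real.log_le_log ?_ hn
    rw [norm_one_sub_cayley_mul_conj]
    have : 0 < |x - y| := by simpa [sub_eq_zero] using h
    positivity

lemma measurable_chordalKernel : Measurable (fun p : ℝ × ℝ => chordalKernel p.1 p.2) := by
  unfold chordalKernel
  fun_prop

lemma measurable_abelKernel (r : ℝ) : Measurable (fun p : ℝ × ℝ => abelKernel r p.1 p.2) := by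
  unfold abelKernel
  have := continuous_cayley.measurable
  have hc : Measurable (conj : ℂ → ℂ) := Complex.continuous_conj.measurable
  fun_prop

lemma norm_cayley_mul_conj (x y : ℝ) : ‖cayley x * conj (cayley y)‖ = 1 := by
  rw [norm_mul, RCLike.norm_conj, norm_cayley, norm_cayley, one_mul]

/-- For `1 / 4 ≤ r < 1` the Abel regularization lies between two integrable bounds. The upper
one uses `|1 - r w|² = (1 - r)² + r |1 - w|² ≥ |1 - w|² / 4` for `|w| = 1`. -/
lemma abs_abelKernel_le {r x y : ℝ} (hr : 1 / 4 ≤ r) (hr1 : r < 1) (hxy : x ≠ y) :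
    |abelKernel r x y| ≤ chordalKernel x y + Real.log 2 := by
  set w := cayley x * conj (cayley y) with hw
  have hw1 : ‖w‖ = 1 := norm_cayley_mul_conj x y
  have hk := chordalKernel_nonneg x y
  have hpos : 0 < ‖1 - r * w‖ := by
    rw [norm_pos_iff, sub_ne_zero]
    intro h
    have := congrArg norm h
    rw [norm_mul, hw1, Complex.norm_real, Real.norm_eq_abs, abs_of_nonneg (by linarith)] at this
    simp at this
    linarith
  have hpos' : 0 < ‖1 - w‖ := by
    rw [hw, norm_one_sub_cayley_mul_conj]
    have : 0 < |x - y| := by simpa [sub_eq_zero] using hxy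
    positivity
  have hle : ‖1 - r * w‖ ≤ 2 := by
    refine (norm_sub_le _ _).trans ?_
    rw [norm_mul, hw1, Complex.norm_real, Real.norm_eq_abs, abs_of_nonneg (by linarith), norm_one]
    linarith
  have hge : ‖1 - w‖ / 2 ≤ ‖1 - r * w‖ := by
    rw [div_le_iff₀ (by norm_num), ← abs_of_nonneg (norm_nonneg (1 - w)),
      ← abs_of_nonneg (show 0 ≤ ‖1 - r * w‖ * 2 by positivity), ← sq_le_sq, mul_pow]
    have h1 : w.re * w.re + w.im * w.im = 1 := by
      rw [← Complex.normSq_apply, Complex.normSq_eq_norm_sq, hw1, one_pow]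
    rw [← Complex.normSq_eq_norm_sq, ← Complex.normSq_eq_norm_sq, Complex.normSq_apply,
      Complex.normSq_apply]
    simp only [Complex.sub_re, Complex.one_re, Complex.sub_im, Complex.one_im, Complex.mul_re,
      Complex.ofReal_re, Complex.ofReal_im, zero_mul, sub_zero, zero_sub, Complex.mul_im, add_zero]
    have hre : w.re ≤ 1 := by nlinarith [mul_self_nonneg w.im]
    nlinarith [mul_nonneg (by linarith : 0 ≤ 4 * r - 1) (by linarith : 0 ≤ 1 - w.re),
      sq_nonneg (1 - r)]
  have h2 : 0 ≤ Real.log 2 := Real.log_nonneg (by norm_num)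
  rw [abelKernel, abs_neg, abs_le]
  constructor
  · have := Real.log_le_log (by positivity) hge
    rw [Real.log_div hpos'.ne' (by norm_num)] at this
    rw [chordalKernel_eq hxy, ← hw]
    linarith
  · have := Real.log_le_log hpos hle
    linarith

lemma tendsto_abelKernel {x y : ℝ} (hxy : x ≠ y) :
    Tendsto (fun r => abelKernel r x y) (𝓝[<] 1) (𝓝 (chordalKernel x y - Real.log 2)) := by
  have h0 : ‖1 - ((1 : ℝ) : ℂ) * (cayley x * conj (cayley y))‖ ≠ 0 := by
    rw [Complex.ofReal_one, one_mul, norm_one_sub_cayley_mul_conj]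
    have : 0 < |x - y| := by simpa [sub_eq_zero] using hxy
    positivity
  have hc : ContinuousAt (fun r => abelKernel r x y) 1 := by
    unfold abelKernel
    have h1 : ContinuousAt (fun r : ℝ => ‖1 - (r : ℂ) * (cayley x * conj (cayley y))‖) 1 := by
      fun_prop
    exact (h1.log h0).neg
  have : abelKernel 1 x y = chordalKernel x y - Real.log 2 := by
    rw [chordalKernel_eq hxy, abelKernel, Complex.ofReal_one, one_mul]
    ring
  rw [← this]
  exact hc.tendsto.mono_left nhdsWithin_le_nhds

/-- The Fourier coefficient `∫ zⁿ dμ` of the image of `μ` on the circle. -/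
def circleMoment (μ : Measure ℝ) (n : ℕ) : ℂ := ∫ x, cayley x ^ n ∂μ

lemma integral_cayley_pow_prod (μ ν : Measure ℝ) [IsProbabilityMeasure μ] [IsProbabilityMeasure ν]
    (n : ℕ) : ∫ p : ℝ × ℝ, (cayley p.1 * conj (cayley p.2)) ^ n ∂(μ.prod ν) =
      circleMoment μ n * conj (circleMoment ν n) := by
  rw [circleMoment, circleMoment, ← integral_conj, ← integral_prod_mul]
  simp [mul_pow]

lemma hasSum_integral_abelKernel (μ ν : Measure ℝ) [IsProbabilityMeasure μ]
    [IsProbabilityMeasure ν] {r : ℝ} (hr : 0 ≤ r) (hr1 : r < 1) :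
    HasSum (fun n : ℕ => r ^ n / n * (circleMoment μ n * conj (circleMoment ν n)).re)
      (∫ p, abelKernel r p.1 p.2 ∂(μ.prod ν)) := by
  set F : ℕ → ℝ × ℝ → ℂ := fun n p => (r * (cayley p.1 * conj (cayley p.2))) ^ n / n with hF
  have hFn : ∀ n p, ‖F n p‖ ≤ r ^ n := by
    intro n p
    rw [hF]
    simp only [norm_div, norm_pow, norm_mul, RCLike.norm_conj, norm_cayley, Complex.norm_real,
      Real.norm_eq_abs, abs_of_nonneg hr, mul_one, Complex.norm_natCast]
    rcases Nat.eq_zero_or_pos n with rfl | hn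
    · simp
    · exact div_le_self (by positivity) (by exact_mod_cast hn)
  have hFc : ∀ n, Continuous (F n) := by
    intro n
    have := continuous_cayley
    have hc := Complex.continuous_conj
    rw [hF]
    fun_prop
  have hFi : ∀ n, Integrable (F n) (μ.prod ν) := fun n =>
    Integrable.of_bound (hFc n).aestronglyMeasurable (r ^ n) (Eventually.of_forall (hFn n))
  have hs : Summable fun n => ∫ p, ‖(F n p).re‖ ∂(μ.prod ν) := by
    refine Summable.of_nonneg_of_le (fun n => integral_nonneg fun _ => norm_nonneg _) (fun n => ?_)
      (summable_geometric_of_lt_one hr hr1)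
    calc ∫ p, ‖(F n p).re‖ ∂(μ.prod ν) ≤ ∫ _, r ^ n ∂(μ.prod ν) :=
          integral_mono (hFi n).re.norm (integrable_const _) fun p =>
            (Complex.abs_re_le_norm _).trans (hFn n p)
      _ = r ^ n := by simp
  have key := hasSum_integral_of_summable_integral_norm (fun n => (hFi n).re) hs
  have e1 : (fun n : ℕ => r ^ n / n * (circleMoment μ n * conj (circleMoment ν n)).re) =
      fun n => ∫ p, (F n p).re ∂(μ.prod ν) := by
    funext n
    have h1 : ∫ p, (F n p).re ∂(μ.prod ν) = (∫ p, F n p ∂(μ.prod ν)).re := integral_re (hFi n)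
    have h2 : ∫ p, F n p ∂(μ.prod ν) =
        ((r ^ n / n : ℝ) : ℂ) * (circleMoment μ n * conj (circleMoment ν n)) := by
      rw [← integral_cayley_pow_prod, ← integral_const_mul]
      congr 1
      funext p
      rw [hF]
      simp only [mul_pow]
      push_cast
      ring
    rw [h1, h2, Complex.re_ofReal_mul]
  have e2 : (fun p : ℝ × ℝ => abelKernel r p.1 p.2) = fun p => ∑' n, (F n p).re := by
    funext p
    have hz : ‖(r : ℂ) * (cayley p.1 * conj (cayley p.2))‖ < 1 := by
      rw [norm_mul, norm_cayley_mul_conj, Complex.norm_real, Real.norm_eq_abs, abs_of_nonneg hr]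
      linarith
    have := Complex.hasSum_re (Complex.hasSum_taylorSeries_neg_log hz)
    rw [this.tsum_eq, Complex.neg_re, Complex.log_re, abelKernel]
  rw [e1, e2]
  exact key

/-- Positive definiteness of the chordal kernel, in quantitative form: each Fourier coefficient of
`ν - μ` is controlled by the energy of `ν - μ`. -/
theorem sq_norm_circleMoment_sub_le (μ ν : Measure ℝ) [IsProbabilityMeasure μ]
    [IsProbabilityMeasure ν]
    (dμμ : ∀ᵐ p ∂(μ.prod μ), p.1 ≠ p.2) (dμν : ∀ᵐ p ∂(ν.prod μ), p.1 ≠ p.2)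
    (dνν : ∀ᵐ p ∂(ν.prod ν), p.1 ≠ p.2)
    (iμμ : Integrable (fun p : ℝ × ℝ => chordalKernel p.1 p.2) (μ.prod μ))
    (iμν : Integrable (fun p : ℝ × ℝ => chordalKernel p.1 p.2) (ν.prod μ))
    (iνν : Integrable (fun p : ℝ × ℝ => chordalKernel p.1 p.2) (ν.prod ν)) (n : ℕ) :
    ‖circleMoment ν n - circleMoment μ n‖ ^ 2 / n ≤
      (∫ p, chordalKernel p.1 p.2 ∂(ν.prod ν)) - 2 * (∫ p, chordalKernel p.1 p.2 ∂(ν.prod μ)) +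
        ∫ p, chordalKernel p.1 p.2 ∂(μ.prod μ) := by
  have lim : ∀ α β : Measure ℝ, IsProbabilityMeasure α → IsProbabilityMeasure β →
      (∀ᵐ p ∂(α.prod β), p.1 ≠ p.2) →
      Integrable (fun p : ℝ × ℝ => chordalKernel p.1 p.2) (α.prod β) →
      Tendsto (fun r => ∫ p, abelKernel r p.1 p.2 ∂(α.prod β)) (𝓝[<] 1)
        (𝓝 ((∫ p, chordalKernel p.1 p.2 ∂(α.prod β)) - Real.log 2)) := by
    intro α β _ _ hd hi
    have h1 : (∫ p, chordalKernel p.1 p.2 ∂(α.prod β)) - Real.log 2 =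
        ∫ p, (chordalKernel p.1 p.2 - Real.log 2) ∂(α.prod β) := by
      rw [integral_sub hi (integrable_const _)]
      simp
    rw [h1]
    refine tendsto_integral_filter_of_dominated_convergence
      (fun p => chordalKernel p.1 p.2 + Real.log 2)
      (Eventually.of_forall fun r => (measurable_abelKernel r).aestronglyMeasurable) ?_
      (hi.add (integrable_const _)) ?_
    · have : ∀ᶠ r : ℝ in 𝓝[<] 1, 1 / 4 ≤ r ∧ r < 1 := by
        filter_upwards [Ioo_mem_nhdsLT (show (1 / 4 : ℝ) < 1 by norm_num)] with r hr
        exact ⟨hr.1.le, hr.2⟩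
      filter_upwards [this] with r hr
      filter_upwards [hd] with p hp
      exact abs_abelKernel_le hr.1 hr.2 hp
    · filter_upwards [hd] with p hp
      exact tendsto_abelKernel hp
  have l1 := ((lim ν ν ‹_› ‹_› dνν iνν).sub ((lim ν μ ‹_› ‹_› dμν iμν).const_mul 2)).add
    (lim μ μ ‹_› ‹_› dμμ iμμ)
  have l2 : Tendsto (fun r : ℝ => r ^ n / n * ‖circleMoment ν n - circleMoment μ n‖ ^ 2) (𝓝[<] 1)
      (𝓝 (‖circleMoment ν n - circleMoment μ n‖ ^ 2 / n)) := by
    have hc : Continuous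
        (fun r : ℝ => r ^ n / n * ‖circleMoment ν n - circleMoment μ n‖ ^ 2) := by
      fun_prop
    have := (hc.tendsto 1).mono_left (nhdsWithin_le_nhds (s := Iio (1 : ℝ)))
    rwa [one_pow, one_div_mul_eq_div] at this
  have := le_of_tendsto_of_tendsto l2 l1 (by
    filter_upwards [Ioo_mem_nhdsLT (show (0 : ℝ) < 1 by norm_num)] with r hr
    have hs := ((hasSum_integral_abelKernel ν ν hr.1.le hr.2).sub
      ((hasSum_integral_abelKernel ν μ hr.1.le hr.2).mul_left 2)).add
      (hasSum_integral_abelKernel μ μ hr.1.le hr.2)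
    have e : ∀ m : ℕ, r ^ m / m * (circleMoment ν m * conj (circleMoment ν m)).re -
        2 * (r ^ m / m * (circleMoment ν m * conj (circleMoment μ m)).re) +
        r ^ m / m * (circleMoment μ m * conj (circleMoment μ m)).re =
        r ^ m / m * ‖circleMoment ν m - circleMoment μ m‖ ^ 2 := by
      intro m
      rw [← Complex.normSq_eq_norm_sq, Complex.normSq_apply]
      simp only [Complex.mul_re, Complex.conj_re, Complex.conj_im, Complex.sub_re, Complex.sub_im]
      ring
    simp only [e] at hs
    have hr0 := hr.1.le
    exact le_hasSum hs n fun m _ => by positivity)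
  linarith

/-- A probability measure on the line is determined by its Fourier coefficients on the circle. -/
theorem eq_of_circleMoment_eq (μ ν : Measure ℝ) [IsProbabilityMeasure μ] [IsProbabilityMeasure ν]
    (h : ∀ n, circleMoment μ n = circleMoment ν n) : μ = ν := by
  set z : BoundedContinuousFunction ℝ ℂ :=
    BoundedContinuousFunction.ofNormedAddCommGroup cayley continuous_cayley 1
      (fun x => (norm_cayley x).le) with hz
  have hzx : ∀ x, z x = cayley x := fun _ => rfl
  refine ext_of_forall_mem_subalgebra_integral_eq_of_polish (𝕜 := ℂ)
    (A := StarAlgebra.adjoin ℂ {z}) ?_ ?_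
  · intro x y hxy
    refine ⟨cayley, ⟨BoundedContinuousFunction.toContinuousMapStarₐ ℂ z, ?_, rfl⟩,
      fun h => hxy (cayley_injective h)⟩
    exact ⟨z, StarAlgebra.self_mem_adjoin_singleton ℂ z, rfl⟩
  · intro g hg
    have hconj : ∀ n, ∫ x, conj (cayley x) ^ n ∂μ = ∫ x, conj (cayley x) ^ n ∂ν := by
      intro n
      simp_rw [← map_pow]
      rw [integral_conj, integral_conj]
      exact congrArg conj (h n)
    -- The adjoined algebra is spanned by the monomials `zᵐ z̄ᵏ`, which reduce to powers of
    -- `z` or of `z̄` because `z z̄ = 1`.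
    have hmono : ∀ m k : ℕ, ∫ x, cayley x ^ m * conj (cayley x) ^ k ∂μ =
        ∫ x, cayley x ^ m * conj (cayley x) ^ k ∂ν := by
      intro m k
      rcases le_total k m with hk | hk
      · obtain ⟨j, rfl⟩ := Nat.exists_eq_add_of_le' hk
        have : ∀ x, cayley x ^ (j + k) * conj (cayley x) ^ k = cayley x ^ j := by
          intro x
          rw [pow_add, mul_assoc, ← mul_pow, cayley_mul_conj, one_pow, mul_one]
        simp_rw [this]
        exact h j
      · obtain ⟨j, rfl⟩ := Nat.exists_eq_add_of_le hk
        have : ∀ x, cayley x ^ m * conj (cayley x) ^ (m + j) = conj (cayley x) ^ j := by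
          intro x
          rw [pow_add, ← mul_assoc, ← mul_pow, cayley_mul_conj, one_pow, one_mul]
        simp_rw [this]
        exact hconj j
    rw [← StarSubalgebra.mem_toSubalgebra, StarAlgebra.adjoin_toSubalgebra,
      ← Subalgebra.mem_toSubmodule, Algebra.adjoin_eq_span] at hg
    induction hg using Submodule.span_induction with
    | mem f hf =>
      have : ∃ m k : ℕ, f = z ^ m * star z ^ k := by
        induction hf using Submonoid.closure_induction with
        | mem f hf =>
          rcases hf with hf | hf
          · rw [mem_singleton_iff] at hf
            exact ⟨1, 0, by simp [hf]⟩
          · rw [Set.mem_star, mem_singleton_iff] at hf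
            exact ⟨0, 1, by simp [← hf]⟩
        | one => exact ⟨0, 0, by simp⟩
        | mul f g _ _ hf hg =>
          obtain ⟨m, k, rfl⟩ := hf
          obtain ⟨m', k', rfl⟩ := hg
          exact ⟨m + m', k + k', by ring⟩
      obtain ⟨m, k, rfl⟩ := this
      exact hmono m k
    | zero => simp
    | add f g _ _ hf hg =>
      have i (ρ : Measure ℝ) [IsProbabilityMeasure ρ] (f : BoundedContinuousFunction ℝ ℂ) :
        Integrable f ρ := BoundedContinuousFunction.integrable ρ f
      simp only [BoundedContinuousFunction.coe_add, Pi.add_apply]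
      rw [integral_add (i μ f) (i μ g), integral_add (i ν f) (i ν g), hf, hg]
    | smul c f _ hf =>
      simp only [BoundedContinuousFunction.coe_smul]
      rw [integral_smul, integral_smul, hf]

/-! ### The Euler–Lagrange criterion -/

lemma weightedKernel_of_ne {V h : ℝ → ℝ} (hV : ∀ x, V x = 1 / 2 * Real.log (1 + x ^ 2) + h x)
    {x y : ℝ} (hxy : x ≠ y) :
    weightedKernel V x y = ((chordalKernel x y + h x + h y : ℝ) : EReal) := by
  rw [weightedKernel, if_neg hxy, hV, hV, one_div, Real.log_inv, chordalKernel]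
  congr 1
  ring

lemma measurable_weightedKernel {V : ℝ → ℝ} (hV : Measurable V) :
    Measurable (fun p : ℝ × ℝ => weightedKernel V p.1 p.2) := by
  unfold weightedKernel
  refine Measurable.ite (measurableSet_eq_fun measurable_fst measurable_snd) measurable_const ?_
  fun_prop

/-- The weighted energy in terms of the nonnegative chordal kernel and the bounded part `h` of the
field. -/
lemma weightedEnergy_eq_chordal {V h : ℝ → ℝ}
    (hV : ∀ x, V x = 1 / 2 * Real.log (1 + x ^ 2) + h x) (ν : Measure ℝ) [IsProbabilityMeasure ν]
    (hh : Integrable h ν) (hd : ∀ᵐ p ∂(ν.prod ν), p.1 ≠ p.2)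
    (hi : Integrable (fun p : ℝ × ℝ => chordalKernel p.1 p.2) (ν.prod ν)) :
    weightedEnergy V ν =
      (((∫ p, chordalKernel p.1 p.2 ∂(ν.prod ν)) + 2 * ∫ x, h x ∂ν : ℝ) : EReal) := by
  have h1 : Integrable (fun p : ℝ × ℝ => h p.1) (ν.prod ν) := hh.comp_fst ν
  have h2 : Integrable (fun p : ℝ × ℝ => h p.2) (ν.prod ν) := hh.comp_snd ν
  have h3 : Integrable (fun p : ℝ × ℝ => chordalKernel p.1 p.2 + h p.1) (ν.prod ν) := hi.add h1
  have hk : Integrable (fun p : ℝ × ℝ => chordalKernel p.1 p.2 + h p.1 + h p.2) (ν.prod ν) :=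
    h3.add h2
  have e1 : ∫⁻ p : ℝ × ℝ, (weightedKernel V p.1 p.2).toENNReal ∂(ν.prod ν) =
      ∫⁻ p : ℝ × ℝ, ENNReal.ofReal (chordalKernel p.1 p.2 + h p.1 + h p.2) ∂(ν.prod ν) := by
    refine lintegral_congr_ae ?_
    filter_upwards [hd] with p hp
    rw [weightedKernel_of_ne hV hp, EReal.real_coe_toENNReal]
  have e2 : ∫⁻ p : ℝ × ℝ, (-weightedKernel V p.1 p.2).toENNReal ∂(ν.prod ν) =
      ∫⁻ p : ℝ × ℝ, ENNReal.ofReal (-(chordalKernel p.1 p.2 + h p.1 + h p.2)) ∂(ν.prod ν) := by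
    refine lintegral_congr_ae ?_
    filter_upwards [hd] with p hp
    rw [weightedKernel_of_ne hV hp, ← EReal.coe_neg, EReal.real_coe_toENNReal]
  have hs : ∫ p : ℝ × ℝ, (chordalKernel p.1 p.2 + h p.1 + h p.2) ∂(ν.prod ν) =
      (∫ p : ℝ × ℝ, chordalKernel p.1 p.2 ∂(ν.prod ν)) + 2 * ∫ x, h x ∂ν := by
    rw [integral_add h3 h2, integral_add hi h1, integral_fun_fst, integral_fun_snd]
    simp
    ring
  have hn : Integrable (fun p : ℝ × ℝ => -(chordalKernel p.1 p.2 + h p.1 + h p.2)) (ν.prod ν) :=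
    hk.neg
  rw [← hs, integral_eq_lintegral_pos_part_sub_lintegral_neg_part hk, weightedEnergy, e1, e2,
    EReal.coe_sub, EReal.coe_ennreal_toReal hk.lintegral_lt_top.ne,
    EReal.coe_ennreal_toReal hn.lintegral_lt_top.ne]

/-- A probability measure of finite energy does not charge the diagonal and has finite chordal
energy. -/
lemma finite_chordal_energy {V h : ℝ → ℝ}
    (hV : ∀ x, V x = 1 / 2 * Real.log (1 + x ^ 2) + h x) (hm : Measurable h) {B : ℝ}
    (hB : ∀ x, |h x| ≤ B) (ν : Measure ℝ) [IsProbabilityMeasure ν] (hE : weightedEnergy V ν ≠ ⊤) :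
    (∀ᵐ p ∂(ν.prod ν), p.1 ≠ p.2) ∧
      Integrable (fun p : ℝ × ℝ => chordalKernel p.1 p.2) (ν.prod ν) := by
  have hB0 : 0 ≤ B := (abs_nonneg _).trans (hB 0)
  have hVm : Measurable V := by
    rw [funext hV]
    fun_prop
  set P := ∫⁻ p : ℝ × ℝ, (weightedKernel V p.1 p.2).toENNReal ∂(ν.prod ν) with hP
  set N := ∫⁻ p : ℝ × ℝ, (-weightedKernel V p.1 p.2).toENNReal ∂(ν.prod ν) with hN
  have hNt : N ≠ ⊤ := by
    have : N ≤ ∫⁻ _, ENNReal.ofReal (2 * B) ∂(ν.prod ν) := by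
      refine lintegral_mono fun p => ?_
      rcases eq_or_ne p.1 p.2 with hp | hp
      · rw [weightedKernel, if_pos hp]
        simp
      · rw [weightedKernel_of_ne hV hp, ← EReal.coe_neg, EReal.real_coe_toENNReal]
        refine ENNReal.ofReal_le_ofReal ?_
        have := chordalKernel_nonneg p.1 p.2
        have := neg_le_of_abs_le (hB p.1)
        have := neg_le_of_abs_le (hB p.2)
        linarith
    refine (this.trans_lt ?_).ne
    rw [lintegral_const, measure_univ, mul_one]
    exact ENNReal.ofReal_lt_top
  have hPt : P ≠ ⊤ := by
    intro hPt
    apply hE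
    rw [weightedEnergy, ← hP, ← hN, hPt, EReal.coe_ennreal_top]
    lift N to NNReal using hNt with n
    exact EReal.top_sub_coe _
  have hmP : Measurable (fun p : ℝ × ℝ => (weightedKernel V p.1 p.2).toENNReal) :=
    (measurable_weightedKernel hVm).ereal_toENNReal
  have hd : ∀ᵐ p ∂(ν.prod ν), p.1 ≠ p.2 := by
    filter_upwards [ae_lt_top hmP hPt] with p hp hpe
    rw [weightedKernel, if_pos hpe] at hp
    simp at hp
  refine ⟨hd, measurable_chordalKernel.aestronglyMeasurable, ?_⟩
  rw [hasFiniteIntegral_iff_ofReal (Eventually.of_forall fun p => chordalKernel_nonneg _ _)]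
  calc ∫⁻ p, ENNReal.ofReal (chordalKernel p.1 p.2) ∂(ν.prod ν)
      ≤ ∫⁻ p, ((weightedKernel V p.1 p.2).toENNReal + ENNReal.ofReal (2 * B)) ∂(ν.prod ν) := by
        refine lintegral_mono_ae ?_
        filter_upwards [hd] with p hp
        rw [weightedKernel_of_ne hV hp, EReal.real_coe_toENNReal]
        refine le_trans (ENNReal.ofReal_le_ofReal ?_) ENNReal.ofReal_add_le
        have := neg_le_of_abs_le (hB p.1)
        have := neg_le_of_abs_le (hB p.2)
        linarith
    _ = P + ENNReal.ofReal (2 * B) := by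
        rw [lintegral_add_left hmP, lintegral_const, measure_univ, mul_one]
    _ < ⊤ := ENNReal.add_lt_top.2 ⟨lt_top_iff_ne_top.2 hPt, ENNReal.ofReal_lt_top⟩

lemma ae_prod_ne (ν μ : Measure ℝ) [IsProbabilityMeasure ν] [IsProbabilityMeasure μ]
    [NullSingletonClass μ] : ∀ᵐ p ∂(ν.prod μ), p.1 ≠ p.2 := by
  have hm : MeasurableSet {p : ℝ × ℝ | p.1 ≠ p.2} :=
    (measurableSet_eq_fun measurable_fst measurable_snd).compl
  rw [Measure.ae_prod_iff_ae_ae hm]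
  refine Eventually.of_forall fun x => ?_
  have : ∀ᵐ y ∂μ, y ≠ x := by simp [ae_iff]
  filter_upwards [this] with y hy using hy.symm

/-- The Euler–Lagrange conditions characterize the equilibrium measure: if the chordal potential of
`μ` is bounded and its sum with `h` is at least `F` everywhere and equal to `F` for `μ`-almost
every point, then `μ` is the unique minimizer. The energy of a competitor `ν` exceeds the energy of
`μ` by at least the chordal energy of `ν - μ`, which is positive definite. -/
theorem isEquilibriumMeasure_of_eulerLagrange {V h : ℝ → ℝ}
    (hV : ∀ x, V x = 1 / 2 * Real.log (1 + x ^ 2) + h x) (hm : Measurable h) {B : ℝ}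
    (hB : ∀ x, |h x| ≤ B) (μ : Measure ℝ) [IsProbabilityMeasure μ] [NullSingletonClass μ]
    (hi : ∀ x, Integrable (chordalKernel x) μ) {M F : ℝ} (hM : ∀ x, ∫ y, chordalKernel x y ∂μ ≤ M)
    (hF : ∀ x, F ≤ (∫ y, chordalKernel x y ∂μ) + h x)
    (hFμ : ∀ᵐ x ∂μ, (∫ y, chordalKernel x y ∂μ) + h x = F) : IsEquilibriumMeasure V μ := by
  set U : ℝ → ℝ := fun x => ∫ y, chordalKernel x y ∂μ with hU
  have hUm : StronglyMeasurable U :=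
    measurable_chordalKernel.stronglyMeasurable.integral_prod_right'
  have hU0 : ∀ x, 0 ≤ U x := fun x => integral_nonneg fun y => chordalKernel_nonneg _ _
  have hUi (ν : Measure ℝ) [IsProbabilityMeasure ν] : Integrable U ν :=
    Integrable.of_bound hUm.aestronglyMeasurable M (Eventually.of_forall fun x => by
      rw [Real.norm_eq_abs, abs_of_nonneg (hU0 x)]
      exact hM x)
  have hhi (ν : Measure ℝ) [IsProbabilityMeasure ν] : Integrable h ν :=
    Integrable.of_bound hm.aestronglyMeasurable B (Eventually.of_forall hB)
  have hpi (ν : Measure ℝ) [IsProbabilityMeasure ν] :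
      Integrable (fun p : ℝ × ℝ => chordalKernel p.1 p.2) (ν.prod μ) := by
    rw [integrable_prod_iff measurable_chordalKernel.aestronglyMeasurable]
    refine ⟨Eventually.of_forall hi, ?_⟩
    refine (hUi ν).congr (Eventually.of_forall fun x => integral_congr_ae
      (Eventually.of_forall fun y => ?_))
    exact (Real.norm_of_nonneg (chordalKernel_nonneg x y)).symm
  have hpU (ν : Measure ℝ) [IsProbabilityMeasure ν] :
      ∫ p, chordalKernel p.1 p.2 ∂(ν.prod μ) = ∫ x, U x ∂ν := integral_prod _ (hpi ν)
  have hEμ := weightedEnergy_eq_chordal hV μ (hhi μ) (ae_prod_ne μ μ) (hpi μ)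
  have hFμ' : (∫ x, U x ∂μ) + ∫ x, h x ∂μ = F := by
    rw [← integral_add (hUi μ) (hhi μ), integral_congr_ae hFμ]
    simp
  have key (ν : Measure ℝ) [IsProbabilityMeasure ν] (hν : weightedEnergy V ν ≠ ⊤) (n : ℕ) :
      weightedEnergy V μ +
        ((‖circleMoment ν n - circleMoment μ n‖ ^ 2 / n : ℝ) : EReal) ≤ weightedEnergy V ν := by
    obtain ⟨hd, hν2⟩ := finite_chordal_energy hV hm hB ν hν
    rw [hEμ, weightedEnergy_eq_chordal hV ν (hhi ν) hd hν2, ← EReal.coe_add, EReal.coe_le_coe_iff]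
    have h1 := sq_norm_circleMoment_sub_le μ ν (ae_prod_ne μ μ) (ae_prod_ne ν μ) hd (hpi μ)
      (hpi ν) hν2 n
    rw [hpU, hpU] at h1
    have h2 : F ≤ (∫ x, U x ∂ν) + ∫ x, h x ∂ν := by
      rw [← integral_add (hUi ν) (hhi ν)]
      have := integral_mono (μ := ν) (integrable_const F) ((hUi ν).add (hhi ν)) hF
      simpa using this
    rw [hpU]
    linarith
  refine ⟨⟨inferInstance, fun ν _ => ?_⟩, fun ν hν => ?_⟩
  · rcases eq_or_ne (weightedEnergy V ν) ⊤ with h | h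
    · rw [h]
      exact le_top
    · have := key ν h 0
      simpa using this
  · have := hν.1
    have hle := hν.2 μ inferInstance
    have hfin : weightedEnergy V ν ≠ ⊤ := by
      intro h
      rw [h, hEμ] at hle
      exact absurd hle (not_le.2 (EReal.coe_lt_top _))
    refine eq_of_circleMoment_eq ν μ fun n => ?_
    rcases Nat.eq_zero_or_pos n with rfl | hn
    · simp [circleMoment]
    · have h1 := (key ν hfin n).trans hle
      rw [hEμ, ← EReal.coe_add, EReal.coe_le_coe_iff] at h1
      have h2 : ‖circleMoment ν n - circleMoment μ n‖ ^ 2 / n ≤ 0 := by linarith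
      have h3 : (0 : ℝ) < n := by exact_mod_cast hn
      rw [div_le_iff₀ h3, zero_mul] at h2
      have h4 : ‖circleMoment ν n - circleMoment μ n‖ = 0 := by
        nlinarith [norm_nonneg (circleMoment ν n - circleMoment μ n)]
      rwa [norm_eq_zero, sub_eq_zero] at h4

/-! ### Logarithmic integrals against the Cauchy distribution -/

lemma circleMap_two_mul_arctan (w : ℝ) : circleMap 0 1 (2 * Real.arctan w) = cayley w := by
  have h1 : (1 - w * Complex.I : ℂ) ≠ 0 := one_sub_mul_I_ne_zero w
  have hs : ((√(1 + w ^ 2) : ℝ) : ℂ) ≠ 0 := by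
    rw [Complex.ofReal_ne_zero]
    positivity
  have hs2 : ((√(1 + w ^ 2) : ℝ) : ℂ) ^ 2 = (1 + w * Complex.I) * (1 - w * Complex.I) := by
    rw [← Complex.ofReal_pow, Real.sq_sqrt (by positivity)]
    push_cast
    linear_combination (w : ℂ) ^ 2 * Complex.I_sq
  have he : Complex.exp ((Real.arctan w : ℝ) * Complex.I) =
      (1 + w * Complex.I) / ((√(1 + w ^ 2) : ℝ) : ℂ) := by
    rw [Complex.exp_mul_I, ← Complex.ofReal_cos, ← Complex.ofReal_sin, Real.cos_arctan,
      Real.sin_arctan]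
    push_cast
    ring
  have : circleMap 0 1 (2 * Real.arctan w) =
      Complex.exp ((Real.arctan w : ℝ) * Complex.I) ^ 2 := by
    rw [circleMap, ← Complex.exp_nat_mul]
    push_cast
    ring_nf
  rw [this, he, div_pow, hs2, cayley]
  have h2 : (1 + w * Complex.I : ℂ) ≠ 0 := by
    intro h
    have := congrArg Complex.re h
    simp at this
  field_simp

lemma hasDerivWithinAt_arctan_univ (w : ℝ) (_ : w ∈ univ) :
    HasDerivWithinAt Real.arctan (1 / (1 + w ^ 2)) univ w :=
  (Real.hasDerivAt_arctan w).hasDerivWithinAt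

/-- Jensen's formula on the circle, transported to the line: the circle average of `log ‖· - a‖`
is `log⁺ ‖a‖`, and the Cauchy distribution is the image of the uniform distribution on the
circle. -/
lemma integral_log_norm_cayley_sub (a : ℂ) :
    Integrable (fun w : ℝ => (1 + w ^ 2)⁻¹ * Real.log ‖cayley w - a‖) ∧
      ∫ w : ℝ, (1 + w ^ 2)⁻¹ * Real.log ‖cayley w - a‖ = Real.pi * Real.posLog ‖a‖ := by
  set f : ℝ → ℝ := fun θ => Real.log ‖circleMap 0 1 θ - a‖ with hf
  have hper : Function.Periodic f (2 * Real.pi) := fun θ => by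
    simp only [hf, periodic_circleMap 0 1 θ]
  have hint : IntervalIntegrable f volume 0 (2 * Real.pi) := circleIntegrable_log_norm_sub_const 1
  have hint' : IntervalIntegrable f volume (-Real.pi) Real.pi :=
    hper.intervalIntegrable₀ Real.two_pi_pos.ne' hint _ _
  have hval : ∫ θ in (-Real.pi)..Real.pi, f θ = 2 * Real.pi * Real.posLog ‖a‖ := by
    have h1 := hper.intervalIntegral_add_eq (-Real.pi) 0
    rw [show -Real.pi + 2 * Real.pi = Real.pi by ring, zero_add] at h1
    rw [h1, ← circleAverage_log_norm_sub_const_eq_posLog, Real.circleAverage_def, smul_eq_mul,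
      mul_inv_cancel_left₀ (by positivity)]
  have hint2 : IntervalIntegrable (fun τ => f (2 * τ)) volume (-(Real.pi / 2)) (Real.pi / 2) := by
    have := hint'.comp_mul_left (c := 2)
    convert! this using 1
    ring
  have hval2 : ∫ τ in (-(Real.pi / 2))..(Real.pi / 2), f (2 * τ) = Real.pi * Real.posLog ‖a‖ := by
    rw [intervalIntegral.integral_comp_mul_left _ (by norm_num : (2 : ℝ) ≠ 0),
      show 2 * -(Real.pi / 2) = -Real.pi by ring, show 2 * (Real.pi / 2) = Real.pi by ring, hval,
      smul_eq_mul]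
    ring
  have hpi : -(Real.pi / 2) ≤ Real.pi / 2 := by linarith [Real.pi_pos]
  have hfw : ∀ w : ℝ, |1 / (1 + w ^ 2)| • f (2 * Real.arctan w) =
      (1 + w ^ 2)⁻¹ * Real.log ‖cayley w - a‖ := by
    intro w
    simp only [hf]
    rw [circleMap_two_mul_arctan, abs_of_nonneg (by positivity), one_div, smul_eq_mul]
  have himg : Real.arctan '' univ = Ioo (-(Real.pi / 2)) (Real.pi / 2) := by
    rw [image_univ, Real.range_arctan]
  rw [intervalIntegrable_iff_integrableOn_Ioo_of_le hpi, ← himg,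
    integrableOn_image_iff_integrableOn_abs_deriv_smul MeasurableSet.univ
      hasDerivWithinAt_arctan_univ Real.arctan_injective.injOn] at hint2
  rw [intervalIntegral.integral_of_le hpi, integral_Ioc_eq_integral_Ioo, ← himg,
    integral_image_eq_integral_abs_deriv_smul MeasurableSet.univ
      hasDerivWithinAt_arctan_univ Real.arctan_injective.injOn] at hval2
  simp only [hfw, Measure.restrict_univ, IntegrableOn] at hint2 hval2
  exact ⟨hint2, hval2⟩

/-- The logarithmic potential of the Cauchy distribution, which is the harmonic measure of the lower
half-plane seen from `-i`. As `log ‖· - z‖` is harmonic there for `z` in the closed upper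
half-plane, its mean is its value at `-i`. -/
theorem integral_log_norm_sub {z : ℂ} (hz : 0 ≤ z.im) :
    Integrable (fun w : ℝ => (1 + w ^ 2)⁻¹ * Real.log ‖(w : ℂ) - z‖) ∧
      ∫ w : ℝ, (1 + w ^ 2)⁻¹ * Real.log ‖(w : ℂ) - z‖ = Real.pi * Real.log ‖z + Complex.I‖ := by
  have hzI : z + Complex.I ≠ 0 := by
    intro h
    have := congrArg Complex.im h
    simp at this
    linarith
  set a : ℂ := (Complex.I - z) / (z + Complex.I) with ha
  have ha1 : ‖a‖ ≤ 1 := by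
    rw [ha, norm_div, div_le_one (norm_pos_iff.2 hzI), ← abs_of_nonneg (norm_nonneg _),
      ← abs_of_nonneg (norm_nonneg (z + Complex.I)), ← sq_le_sq, ← Complex.normSq_eq_norm_sq,
      ← Complex.normSq_eq_norm_sq, Complex.normSq_apply, Complex.normSq_apply]
    simp only [Complex.sub_re, Complex.I_re, Complex.sub_im, Complex.I_im, Complex.add_re,
      Complex.add_im]
    nlinarith
  obtain ⟨i1, v1⟩ := integral_log_norm_cayley_sub a
  obtain ⟨i2, v2⟩ := integral_log_norm_cayley_sub (-1)
  rw [(Real.posLog_eq_zero_iff _).2 (by rwa [abs_of_nonneg (norm_nonneg _)]), mul_zero] at v1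
  rw [norm_neg, norm_one, (Real.posLog_eq_zero_iff _).2 (by simp), mul_zero] at v2
  have i3 : Integrable (fun w : ℝ => (1 + w ^ 2)⁻¹ * Real.log ‖z + Complex.I‖) :=
    integrable_inv_one_add_sq.mul_const _
  have hae : (fun w : ℝ => (1 + w ^ 2)⁻¹ * Real.log ‖cayley w - a‖ -
      (1 + w ^ 2)⁻¹ * Real.log ‖cayley w - -1‖ + (1 + w ^ 2)⁻¹ * Real.log ‖z + Complex.I‖)
      =ᵐ[volume] fun w => (1 + w ^ 2)⁻¹ * Real.log ‖(w : ℂ) - z‖ := by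
    have hne : ∀ᵐ w : ℝ, w ≠ z.re := by simp [ae_iff]
    filter_upwards [hne] with w hw
    have hwz : (w : ℂ) - z ≠ 0 := by
      intro h
      have := congrArg Complex.re h
      simp at this
      exact hw (by linarith)
    have hI := one_sub_mul_I_ne_zero w
    have e1 : cayley w - a = 2 * (z - w) / ((1 - w * Complex.I) * (z + Complex.I)) := by
      rw [cayley, ha, div_sub_div _ _ hI hzI]
      congr 1
      linear_combination 2 * (w : ℂ) * Complex.I_sq
    have e2 : cayley w - -1 = 2 / (1 - w * Complex.I) := by
      rw [cayley]
      field_simp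
      ring
    have hIn := norm_pos_iff.2 hI
    have hzn := norm_pos_iff.2 hzI
    have hwn := norm_pos_iff.2 hwz
    have h2 : (0 : ℝ) < ‖(2 : ℂ)‖ := by simp
    rw [e1, e2, norm_div, norm_div, norm_mul, norm_mul, norm_sub_rev z,
      Real.log_div (by positivity) (by positivity), Real.log_div (by positivity) (by positivity),
      Real.log_mul (by positivity) (by positivity), Real.log_mul (by positivity) (by positivity)]
    ring
  refine ⟨((i1.sub i2).add i3).congr hae, ?_⟩
  have i12 : Integrable (fun w : ℝ => (1 + w ^ 2)⁻¹ * Real.log ‖cayley w - a‖ -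
      (1 + w ^ 2)⁻¹ * Real.log ‖cayley w - -1‖) := i1.sub i2
  rw [← integral_congr_ae hae, integral_add i12 i3, integral_sub i1 i2, v1, v2,
    integral_mul_const, integral_univ_inv_one_add_sq]
  ring

lemma integral_log_abs_sub (t : ℝ) :
    Integrable (fun w : ℝ => (1 + w ^ 2)⁻¹ * Real.log |t - w|) ∧
      ∫ w : ℝ, (1 + w ^ 2)⁻¹ * Real.log |t - w| = Real.pi * (1 / 2 * Real.log (1 + t ^ 2)) := by
  have h := integral_log_norm_sub (z := t) (by simp)
  have e : ∀ w : ℝ, ‖(w : ℂ) - t‖ = |t - w| := by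
    intro w
    rw [← Complex.ofReal_sub, Complex.norm_real, Real.norm_eq_abs, abs_sub_comm]
  have e2 : Real.log ‖(t : ℂ) + Complex.I‖ = 1 / 2 * Real.log (1 + t ^ 2) := by
    rw [Complex.norm_eq_sqrt_sq_add_sq, Real.log_sqrt (by positivity)]
    simp
    ring_nf
  simpa only [e, e2] using h

lemma integral_log_sq_add_sq {p q : ℝ} (hp : 0 ≤ p) (hq : 0 ≤ q) (hpq : 0 < p + q) :
    Integrable (fun w : ℝ => (1 + w ^ 2)⁻¹ * Real.log (p ^ 2 + q ^ 2 * w ^ 2)) ∧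
      ∫ w : ℝ, (1 + w ^ 2)⁻¹ * Real.log (p ^ 2 + q ^ 2 * w ^ 2) =
        Real.pi * (2 * Real.log (p + q)) := by
  rcases hq.eq_or_lt with rfl | hq
  · have e : ∀ w : ℝ, (1 + w ^ 2)⁻¹ * Real.log (p ^ 2 + 0 ^ 2 * w ^ 2) =
        (1 + w ^ 2)⁻¹ * (2 * Real.log p) := by
      intro w
      rw [zero_pow two_ne_zero, zero_mul, add_zero, Real.log_pow]
      norm_num
    simp only [e]
    refine ⟨integrable_inv_one_add_sq.mul_const _, ?_⟩
    rw [integral_mul_const, integral_univ_inv_one_add_sq, add_zero]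
  obtain ⟨i, v⟩ := integral_log_norm_sub (z := ((p / q : ℝ) : ℂ) * Complex.I)
    (by simp; positivity)
  have hae : (fun w : ℝ => 2 * ((1 + w ^ 2)⁻¹ *
      Real.log ‖(w : ℂ) - ((p / q : ℝ) : ℂ) * Complex.I‖) + (1 + w ^ 2)⁻¹ * (2 * Real.log q))
      =ᵐ[volume] fun w => (1 + w ^ 2)⁻¹ * Real.log (p ^ 2 + q ^ 2 * w ^ 2) := by
    have hne : ∀ᵐ w : ℝ, w ≠ 0 := by simp [ae_iff]
    filter_upwards [hne] with w hw
    have : p ^ 2 + q ^ 2 * w ^ 2 = q ^ 2 * (w ^ 2 + (p / q) ^ 2) := by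
      field_simp
      ring
    rw [this, Real.log_mul (by positivity) (by positivity), Real.log_pow,
      Complex.norm_eq_sqrt_sq_add_sq, Real.log_sqrt (by positivity)]
    simp
    ring
  have hv : Real.log ‖((p / q : ℝ) : ℂ) * Complex.I + Complex.I‖ =
      Real.log (p + q) - Real.log q := by
    rw [← add_one_mul, norm_mul, Complex.norm_I, mul_one, ← Real.log_div (by positivity) hq.ne',
      ← Complex.ofReal_one, ← Complex.ofReal_add, Complex.norm_real,
      Real.norm_of_nonneg (by positivity)]
    congr 1
    field_simp
  have i2 : Integrable (fun w : ℝ => (1 + w ^ 2)⁻¹ * (2 * Real.log q)) :=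
    integrable_inv_one_add_sq.mul_const _
  refine ⟨((i.const_mul 2).add i2).congr hae, ?_⟩
  rw [← integral_congr_ae hae, integral_add (i.const_mul 2) i2, integral_const_mul, v, hv,
    integral_mul_const, integral_univ_inv_one_add_sq]
  ring

lemma integral_log_abs_sub_mul (p : ℝ) {q : ℝ} (hq : q ≠ 0) :
    Integrable (fun w : ℝ => (1 + w ^ 2)⁻¹ * Real.log |p - q * w|) ∧
      ∫ w : ℝ, (1 + w ^ 2)⁻¹ * Real.log |p - q * w| =
        Real.pi * (1 / 2 * Real.log (p ^ 2 + q ^ 2)) := by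
  obtain ⟨i, v⟩ := integral_log_abs_sub (p / q)
  have hae : (fun w : ℝ => (1 + w ^ 2)⁻¹ * Real.log |p / q - w| + (1 + w ^ 2)⁻¹ * Real.log |q|)
      =ᵐ[volume] fun w => (1 + w ^ 2)⁻¹ * Real.log |p - q * w| := by
    have hne : ∀ᵐ w : ℝ, w ≠ p / q := by simp [ae_iff]
    filter_upwards [hne] with w hw
    have : p - q * w = q * (p / q - w) := by field_simp
    have h0 : p / q - w ≠ 0 := by rw [sub_ne_zero]; exact hw.symm
    rw [this, abs_mul, Real.log_mul (by positivity) (by positivity)]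
    ring
  have i2 : Integrable (fun w : ℝ => (1 + w ^ 2)⁻¹ * Real.log |q|) :=
    integrable_inv_one_add_sq.mul_const _
  refine ⟨(i.add i2).congr hae, ?_⟩
  have : p ^ 2 + q ^ 2 = q ^ 2 * (1 + (p / q) ^ 2) := by
    field_simp
    ring
  rw [← integral_congr_ae hae, integral_add i i2, v, integral_mul_const,
    integral_univ_inv_one_add_sq, this, Real.log_mul (by positivity) (by positivity), Real.log_pow,
    Real.log_abs]
  push_cast
  ring

/-! ### Measures dominated by the Cauchy distribution -/

/-- The Cauchy distribution, being the uniform distribution on the circle, has constant chordal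
potential. -/
lemma integral_chordalKernel_cauchy (x : ℝ) :
    Integrable (fun y => (1 + y ^ 2)⁻¹ * chordalKernel x y) ∧
      ∫ y, (1 + y ^ 2)⁻¹ * chordalKernel x y = Real.pi * Real.log 2 := by
  obtain ⟨i1, v1⟩ := integral_log_sq_add_sq zero_le_one zero_le_one (by norm_num)
  simp only [one_pow, one_mul] at i1 v1
  obtain ⟨i2, v2⟩ := integral_log_abs_sub x
  have i3 : Integrable (fun y : ℝ => (1 + y ^ 2)⁻¹ * (1 / 2 * Real.log (1 + x ^ 2))) :=
    integrable_inv_one_add_sq.mul_const _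
  have i4 : Integrable (fun y : ℝ => (1 + y ^ 2)⁻¹ * (1 / 2 * Real.log (1 + x ^ 2)) +
      1 / 2 * ((1 + y ^ 2)⁻¹ * Real.log (1 + y ^ 2))) := i3.add (i1.const_mul _)
  have e : (fun y => (1 + y ^ 2)⁻¹ * chordalKernel x y) = fun y =>
      (1 + y ^ 2)⁻¹ * (1 / 2 * Real.log (1 + x ^ 2)) +
      1 / 2 * ((1 + y ^ 2)⁻¹ * Real.log (1 + y ^ 2)) - (1 + y ^ 2)⁻¹ * Real.log |x - y| := by
    funext y
    rw [chordalKernel]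
    ring
  refine ⟨e ▸ i4.sub i2, ?_⟩
  rw [e, integral_sub i4 i2, integral_add i3 (i1.const_mul _), integral_mul_const,
    integral_const_mul, v1, v2, integral_univ_inv_one_add_sq]
  norm_num
  ring

lemma integrable_mul_of_le_cauchy {ρ g : ℝ → ℝ} {K : ℝ} (hρm : Measurable ρ) (hρ0 : ∀ y, 0 ≤ ρ y)
    (hρK : ∀ y, ρ y ≤ K * (1 + y ^ 2)⁻¹) (hg : Measurable g)
    (hi : Integrable (fun y : ℝ => (1 + y ^ 2)⁻¹ * g y)) : Integrable (fun y => ρ y * g y) := by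
  refine Integrable.mono' (hi.norm.const_mul K) (hρm.mul hg).aestronglyMeasurable
    (Eventually.of_forall fun y => ?_)
  rw [norm_mul, norm_mul, Real.norm_of_nonneg (hρ0 y), ← mul_assoc,
    Real.norm_of_nonneg (show 0 ≤ (1 + y ^ 2)⁻¹ by positivity)]
  gcongr
  exact hρK y

/-- The Euler–Lagrange criterion for a measure whose density is dominated by the Cauchy density.
The domination bounds the chordal potential and makes all logarithmic integrals converge. -/
theorem isEquilibriumMeasure_withDensity {V h ρ : ℝ → ℝ}
    (hV : ∀ x, V x = 1 / 2 * Real.log (1 + x ^ 2) + h x) (hm : Measurable h) {B : ℝ}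
    (hB : ∀ x, |h x| ≤ B) (hρm : Measurable ρ) (hρ0 : ∀ y, 0 ≤ ρ y) {K : ℝ}
    (hρK : ∀ y, ρ y ≤ K * (1 + y ^ 2)⁻¹) (hρ1 : ∫ y, ρ y = 1) {F : ℝ}
    (hF : ∀ x, F ≤ V x - ∫ y, ρ y * Real.log |x - y|)
    (hFρ : ∀ x, ρ x ≠ 0 → V x - ∫ y, ρ y * Real.log |x - y| = F) :
    IsEquilibriumMeasure V (volume.withDensity fun x => ENNReal.ofReal (ρ x)) := by
  set μ : Measure ℝ := volume.withDensity fun x => ENNReal.ofReal (ρ x) with hμ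
  have hρi : Integrable ρ := by
    have := integrable_mul_of_le_cauchy (g := fun _ => 1) hρm hρ0 hρK measurable_const
      (by simpa using integrable_inv_one_add_sq)
    simpa using this
  have : IsProbabilityMeasure μ := by
    constructor
    rw [hμ, withDensity_apply _ MeasurableSet.univ, Measure.restrict_univ,
      ← ofReal_integral_eq_lintegral_ofReal hρi (Eventually.of_forall hρ0), hρ1, ENNReal.ofReal_one]
  have : NullSingletonClass μ := by
    constructor
    intro x
    exact hμ ▸ withDensity_absolutelyContinuous _ _ Real.volume_singleton
  have hint (g : ℝ → ℝ) : ∫ y, g y ∂μ = ∫ y, ρ y * g y := by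
    rw [hμ, integral_withDensity_eq_integral_toReal_smul (by fun_prop)
      (Eventually.of_forall fun _ => ENNReal.ofReal_lt_top)]
    simp only [ENNReal.toReal_ofReal (hρ0 _), smul_eq_mul]
  have hintb (g : ℝ → ℝ) : Integrable g μ ↔ Integrable (fun y => ρ y * g y) := by
    rw [hμ, integrable_withDensity_iff_integrable_smul' (by fun_prop)
      (Eventually.of_forall fun _ => ENNReal.ofReal_lt_top)]
    simp only [ENNReal.toReal_ofReal (hρ0 _), smul_eq_mul]
  have hkm (x : ℝ) : Measurable (chordalKernel x) := by
    unfold chordalKernel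
    fun_prop
  have hki (x : ℝ) : Integrable (fun y => ρ y * chordalKernel x y) :=
    integrable_mul_of_le_cauchy (g := chordalKernel x) hρm hρ0 hρK (hkm x)
      (integral_chordalKernel_cauchy x).1
  have hli (x : ℝ) : Integrable (fun y => ρ y * Real.log |x - y|) :=
    integrable_mul_of_le_cauchy (g := fun y => Real.log |x - y|) hρm hρ0 hρK (by fun_prop)
      (integral_log_abs_sub x).1
  have hwi : Integrable (fun y => ρ y * Real.log (1 + y ^ 2)) := by
    refine integrable_mul_of_le_cauchy (g := fun y => Real.log (1 + y ^ 2)) hρm hρ0 hρK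
      (by fun_prop) ?_
    simpa only [one_pow, one_mul] using
      (integral_log_sq_add_sq zero_le_one zero_le_one (by norm_num)).1
  -- The chordal potential is the logarithmic potential up to a constant and the logarithmic part
  -- of the field.
  have hU (x : ℝ) : (∫ y, chordalKernel x y ∂μ) + h x =
      V x - (∫ y, ρ y * Real.log |x - y|) + 1 / 2 * ∫ y, ρ y * Real.log (1 + y ^ 2) := by
    have i1 : Integrable (fun y => ρ y * (1 / 2 * Real.log (1 + x ^ 2)) +
        1 / 2 * (ρ y * Real.log (1 + y ^ 2))) := (hρi.mul_const _).add (hwi.const_mul _)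
    have e : (fun y => ρ y * chordalKernel x y) = fun y =>
        ρ y * (1 / 2 * Real.log (1 + x ^ 2)) + 1 / 2 * (ρ y * Real.log (1 + y ^ 2)) -
          ρ y * Real.log |x - y| := by
      funext y
      rw [chordalKernel]
      ring
    rw [hint, e, integral_sub i1 (hli x), integral_add (hρi.mul_const _) (hwi.const_mul _),
      integral_mul_const, integral_const_mul, hρ1, hV]
    ring
  refine isEquilibriumMeasure_of_eulerLagrange hV hm hB μ (fun x => (hintb _).2 (hki x))
    (M := K * (Real.pi * Real.log 2))
    (F := F + 1 / 2 * ∫ y, ρ y * Real.log (1 + y ^ 2)) (fun x => ?_) (fun x => ?_) ?_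
  · obtain ⟨i, v⟩ := integral_chordalKernel_cauchy x
    rw [hint, ← v, ← integral_const_mul]
    refine integral_mono (hki x) (i.const_mul K) fun y => ?_
    have := mul_le_mul_of_nonneg_right (hρK y) (chordalKernel_nonneg x y)
    rwa [mul_assoc] at this
  · rw [hU]
    linarith [hF x]
  · rw [hμ, ae_withDensity_iff (by fun_prop)]
    refine Eventually.of_forall fun x hx => ?_
    rw [← hμ, hU, hFρ x fun h0 => hx (by simp [h0])]

lemma support_withDensity_of_continuous {ρ : ℝ → ℝ} (hρ : Continuous ρ) (hρ0 : ∀ x, 0 ≤ ρ x) :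
    (volume.withDensity fun x => ENNReal.ofReal (ρ x)).support = tsupport ρ := by
  ext x
  rw [Measure.support_eq_forall_isOpen, tsupport, mem_closure_iff, mem_ofPred_eq]
  refine ⟨fun h o ho hx => ?_, fun h o hx ho => ?_⟩
  · by_contra hne
    have hz : ∀ y ∈ o, ρ y = 0 := fun y hy => by
      by_contra h0
      exact hne ⟨y, hy, h0⟩
    refine (h o hx ho).ne' ?_
    rw [withDensity_apply _ ho.measurableSet, setLIntegral_congr_fun (g := fun _ => 0)
      ho.measurableSet fun y hy => by simp [hz y hy]]
    simp
  · obtain ⟨y, hyo, hy⟩ := h o ho hx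
    have ho' : IsOpen (o ∩ Function.support ρ) := ho.inter hρ.isOpen_support
    have hpos : 0 < volume (o ∩ Function.support ρ) := ho'.measure_pos volume ⟨y, hyo, hy⟩
    rw [pos_iff_ne_zero, Ne, withDensity_apply_eq_zero (by fun_prop)]
    refine (hpos.trans_le (measure_mono ?_)).ne'
    rintro z ⟨hzo, hz⟩
    refine ⟨?_, hzo⟩
    simpa using lt_of_le_of_ne (hρ0 z) (Ne.symm hz)

/-! ### The subcritical case -/

lemma integral_cauchy_map {ψ ψ' ρ : ℝ → ℝ} (hψ : ∀ w, HasDerivAt ψ (ψ' w) w)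
    (hinj : Function.Injective ψ) (hρ : ∀ w, |ψ' w| * ρ (ψ w) = Real.pi⁻¹ * (1 + w ^ 2)⁻¹)
    {g : ℝ → ℝ} (hg : Integrable fun w => (1 + w ^ 2)⁻¹ * g (ψ w)) :
    IntegrableOn (fun y => ρ y * g y) (range ψ) ∧
      ∫ y in range ψ, ρ y * g y = Real.pi⁻¹ * ∫ w, (1 + w ^ 2)⁻¹ * g (ψ w) := by
  have e : ∀ w, |ψ' w| • (ρ (ψ w) * g (ψ w)) = Real.pi⁻¹ * ((1 + w ^ 2)⁻¹ * g (ψ w)) := by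
    intro w
    rw [smul_eq_mul, ← mul_assoc, hρ, mul_assoc]
  have hd : ∀ w ∈ univ, HasDerivWithinAt ψ (ψ' w) univ w := fun w _ => (hψ w).hasDerivWithinAt
  rw [← image_univ, integrableOn_image_iff_integrableOn_abs_deriv_smul MeasurableSet.univ hd
    hinj.injOn, integral_image_eq_integral_abs_deriv_smul MeasurableSet.univ hd hinj.injOn]
  simp only [e, Measure.restrict_univ, IntegrableOn]
  exact ⟨hg.const_mul _, integral_const_mul _ _⟩

/-- The Cauchy density of scale `c`: the balayage onto the line of a unit charge at `i c`. -/
def cauchyDensity (c y : ℝ) : ℝ := c / (Real.pi * (y ^ 2 + c ^ 2))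

lemma integral_cauchyDensity {c : ℝ} (hc : 0 < c) {g : ℝ → ℝ}
    (hg : Integrable fun w : ℝ => (1 + w ^ 2)⁻¹ * g (c * w)) :
    Integrable (fun y => cauchyDensity c y * g y) ∧
      ∫ y, cauchyDensity c y * g y = Real.pi⁻¹ * ∫ w : ℝ, (1 + w ^ 2)⁻¹ * g (c * w) := by
  have hr : range (fun w => c * w) = univ := (mul_left_surjective₀ hc.ne').range_eq
  have := integral_cauchy_map (ψ := fun w => c * w) (ψ' := fun _ => c) (ρ := cauchyDensity c)
    (fun w => by simpa using (hasDerivAt_id w).const_mul c) (mul_right_injective₀ hc.ne')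
    (fun w => by
      have := Real.pi_pos
      rw [abs_of_pos hc, cauchyDensity, show (c * w) ^ 2 + c ^ 2 = c ^ 2 * (1 + w ^ 2) by ring]
      field_simp) hg
  rw [hr, IntegrableOn, Measure.restrict_univ] at this
  exact this

lemma integral_cauchyDensity_one {c : ℝ} (hc : 0 < c) :
    Integrable (cauchyDensity c) ∧ ∫ y, cauchyDensity c y = 1 := by
  have := integral_cauchyDensity hc (g := fun _ => 1)
    (by simpa using integrable_inv_one_add_sq)
  simp only [mul_one, integral_univ_inv_one_add_sq] at this
  rwa [inv_mul_cancel₀ Real.pi_ne_zero] at this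

lemma integral_cauchyDensity_log {c : ℝ} (hc : 0 < c) (x : ℝ) :
    Integrable (fun y => cauchyDensity c y * Real.log |x - y|) ∧
      ∫ y, cauchyDensity c y * Real.log |x - y| = 1 / 2 * Real.log (x ^ 2 + c ^ 2) := by
  obtain ⟨i, v⟩ := integral_log_abs_sub_mul x hc.ne'
  have := integral_cauchyDensity hc (g := fun y => Real.log |x - y|) i
  rwa [v, inv_mul_cancel_left₀ Real.pi_ne_zero] at this

lemma cauchyDensity_nonneg {c : ℝ} (hc : 0 < c) (y : ℝ) : 0 ≤ cauchyDensity c y := by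
  have := Real.pi_pos
  unfold cauchyDensity
  positivity

lemma subcriticalDensity_eq {a b : ℝ} (hb : 0 < b) (x : ℝ) : subcriticalDensity a b x =
    (1 + a) * cauchyDensity b⁻¹ x - a * cauchyDensity b x := by
  have := Real.pi_pos
  have h1 : x ^ 2 + b ^ 2 ≠ 0 := by positivity
  have h2 : x ^ 2 * b ^ 2 + 1 ≠ 0 := by positivity
  rw [subcriticalDensity, cauchyDensity, cauchyDensity]
  field_simp
  ring

lemma abs_log_sub_log_le {p : ℝ} (hp : 0 < p) (x : ℝ) :
    |Real.log (x ^ 2 + p) - Real.log (1 + x ^ 2)| ≤ |Real.log p| := by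
  have h1 : 0 < 1 + x ^ 2 := by positivity
  have h2 : 0 < x ^ 2 + p := by positivity
  have hx := sq_nonneg x
  rw [← Real.log_div h2.ne' h1.ne']
  rcases le_total 1 p with h | h
  · have h3 : 1 ≤ (x ^ 2 + p) / (1 + x ^ 2) := by
      rw [le_div_iff₀ h1]
      linarith
    have h4 : (x ^ 2 + p) / (1 + x ^ 2) ≤ p := by
      rw [div_le_iff₀ h1]
      nlinarith
    rw [abs_of_nonneg (Real.log_nonneg h3), abs_of_nonneg (Real.log_nonneg h)]
    exact Real.log_le_log (by positivity) h4
  · have h3 : (x ^ 2 + p) / (1 + x ^ 2) ≤ 1 := by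
      rw [div_le_iff₀ h1]
      linarith
    have h4 : p ≤ (x ^ 2 + p) / (1 + x ^ 2) := by
      rw [le_div_iff₀ h1]
      nlinarith
    rw [abs_of_nonpos (Real.log_nonpos (by positivity) h3), abs_of_nonpos
      (Real.log_nonpos hp.le h)]
    exact neg_le_neg (Real.log_le_log hp h4)

lemma tendsto_log_sub_log {p : ℝ} (hp : 0 < p) :
    Tendsto (fun x : ℝ => Real.log (x ^ 2 + p) - Real.log (1 + x ^ 2)) (cocompact ℝ) (𝓝 0) := by
  have hsq : Tendsto (fun x : ℝ => 1 + x ^ 2) (cocompact ℝ) atTop := by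
    refine tendsto_atTop_add_const_left _ _ ?_
    have := (tendsto_pow_atTop two_ne_zero).comp (tendsto_norm_cocompact_atTop (E := ℝ))
    simpa [Function.comp_def] using this
  have h1 : Tendsto (fun x : ℝ => 1 + (p - 1) * (1 + x ^ 2)⁻¹) (cocompact ℝ) (𝓝 1) := by
    have := ((tendsto_inv_atTop_zero.comp hsq).const_mul (p - 1)).const_add 1
    simpa using this
  have h2 := h1.log one_ne_zero
  rw [Real.log_one] at h2
  refine h2.congr fun x => ?_
  rw [← Real.log_div (by positivity) (by positivity)]
  congr 1
  field_simp
  ring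

/-- The bounded part of the external field, left after removing `log (1 + x²) / 2`. -/
def fieldRemainder (a b x : ℝ) : ℝ :=
  (1 + a) / 2 * (Real.log (x ^ 2 + (b ^ 2)⁻¹) - Real.log (1 + x ^ 2)) -
    a / 2 * (Real.log (x ^ 2 + b ^ 2) - Real.log (1 + x ^ 2))

lemma field_eq (a b x : ℝ) : field a b x = 1 / 2 * Real.log (1 + x ^ 2) + fieldRemainder a b x := by
  rw [field, fieldRemainder]
  ring

lemma measurable_fieldRemainder (a b : ℝ) : Measurable (fieldRemainder a b) := by
  unfold fieldRemainder
  fun_prop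

lemma abs_fieldRemainder_le {a b : ℝ} (ha : 0 < a) (hb : 0 < b) (x : ℝ) : |fieldRemainder a b x| ≤
    (1 + a) / 2 * |Real.log (b ^ 2)⁻¹| + a / 2 * |Real.log (b ^ 2)| := by
  rw [fieldRemainder]
  refine (abs_sub _ _).trans ?_
  rw [abs_mul, abs_mul, abs_of_nonneg (show 0 ≤ (1 + a) / 2 by positivity),
    abs_of_nonneg (show 0 ≤ a / 2 by positivity)]
  exact add_le_add
    (mul_le_mul_of_nonneg_left (abs_log_sub_log_le (by positivity) x) (by positivity))
    (mul_le_mul_of_nonneg_left (abs_log_sub_log_le (by positivity) x) (by positivity))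

lemma isWeaklyAdmissible_field (a : ℝ) {b : ℝ} (hb : 0 < b) : IsWeaklyAdmissible (field a b) := by
  constructor
  · refine Continuous.lowerSemicontinuous ?_
    unfold field
    have h1 : ∀ x : ℝ, x ^ 2 + (b ^ 2)⁻¹ ≠ 0 := fun x => by positivity
    have h2 : ∀ x : ℝ, x ^ 2 + b ^ 2 ≠ 0 := fun x => by positivity
    fun_prop (disch := assumption)
  · refine ⟨0, ?_⟩
    have h := ((tendsto_log_sub_log (p := (b ^ 2)⁻¹) (by positivity)).const_mul ((1 + a) / 2)).sub
      ((tendsto_log_sub_log (p := b ^ 2) (by positivity)).const_mul (a / 2))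
    rw [mul_zero, mul_zero, sub_zero] at h
    refine h.congr fun x => ?_
    rw [field_eq, fieldRemainder]
    ring

/-- Below the critical charge the sweeping of the charges `1 + a` and `-a` onto the line is a
positive measure, and its potential cancels the field exactly. -/
theorem isEquilibriumMeasure_subcritical {a b : ℝ} (ha : 0 < a) (hb : 1 ≤ b)
    (h0 : ∀ x, 0 ≤ subcriticalDensity a b x) : IsEquilibriumMeasure (field a b)
      (volume.withDensity fun x => ENNReal.ofReal (subcriticalDensity a b x)) := by
  have hb0 : 0 < b := by linarith
  have hb1 : 0 < b⁻¹ := by positivity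
  obtain ⟨i1, v1⟩ := integral_cauchyDensity_one hb1
  obtain ⟨i2, v2⟩ := integral_cauchyDensity_one hb0
  have hpot (x : ℝ) : ∫ y, subcriticalDensity a b y * Real.log |x - y| = field a b x := by
    obtain ⟨j1, w1⟩ := integral_cauchyDensity_log hb1 x
    obtain ⟨j2, w2⟩ := integral_cauchyDensity_log hb0 x
    have e : (fun y => subcriticalDensity a b y * Real.log |x - y|) = fun y =>
        (1 + a) * (cauchyDensity b⁻¹ y * Real.log |x - y|) -
          a * (cauchyDensity b y * Real.log |x - y|) := by
      funext y
      rw [subcriticalDensity_eq hb0]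
      ring
    rw [e, integral_sub (j1.const_mul _) (j2.const_mul _), integral_const_mul, integral_const_mul,
      w1, w2, field, inv_pow]
    ring
  refine isEquilibriumMeasure_withDensity (field_eq a b) (measurable_fieldRemainder a b)
    (abs_fieldRemainder_le ha hb0) ?_ h0 (K := (1 + a) * (b / Real.pi)) (fun y => ?_) ?_ (F := 0)
    (fun x => ?_) (fun x _ => ?_)
  · unfold subcriticalDensity
    fun_prop
  · rw [subcriticalDensity_eq hb0]
    have h1 : cauchyDensity b⁻¹ y ≤ b / Real.pi * (1 + y ^ 2)⁻¹ := by
      have := Real.pi_pos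
      have e : cauchyDensity b⁻¹ y = b / (Real.pi * (b ^ 2 * y ^ 2 + 1)) := by
        rw [cauchyDensity]
        field_simp
      rw [e, div_mul_eq_mul_div, ← div_eq_mul_inv, div_div]
      have h3 : 1 ≤ b ^ 2 := one_le_pow₀ hb
      have h4 : 1 + y ^ 2 ≤ b ^ 2 * y ^ 2 + 1 := by nlinarith [sq_nonneg y]
      rw [mul_comm (1 + y ^ 2)]
      gcongr b / (_ * ?_)
    have h2 := mul_nonneg ha.le (cauchyDensity_nonneg hb0 y)
    have h3 := mul_le_mul_of_nonneg_left h1 (show 0 ≤ 1 + a by linarith)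
    linarith
  · simp only [subcriticalDensity_eq hb0]
    rw [integral_sub (i1.const_mul _) (i2.const_mul _), integral_const_mul, integral_const_mul,
      v1, v2]
    ring
  · rw [hpot, sub_self]
  · rw [hpot, sub_self]

/-! ### Balayage onto an interval -/

/-- The ratio `c / √(A² + c²)`, by which the interval `[-A, A]` seen from `i c` is parametrized by
the Cauchy distribution. -/
def aspectRatio (A c : ℝ) : ℝ := c / √(A ^ 2 + c ^ 2)

/-- The density of the balayage onto `[-A, A]` of a unit charge at `i c`. -/
def balayageDensity (A c y : ℝ) : ℝ :=
  aspectRatio A c * (A ^ 2 + c ^ 2) / (Real.pi * √(A ^ 2 - y ^ 2) * (y ^ 2 + c ^ 2))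

/-- The map from the line onto `(-A, A)` that carries the Cauchy distribution to the balayage
density, for `k` the aspect ratio. -/
def intervalMap (A k w : ℝ) : ℝ := A * (k * w) / √(1 + (k * w) ^ 2)

lemma aspectRatio_pos {A c : ℝ} (hc : 0 < c) : 0 < aspectRatio A c := by
  unfold aspectRatio
  positivity

lemma aspectRatio_sq {A c : ℝ} (hc : 0 < c) : aspectRatio A c ^ 2 * (A ^ 2 + c ^ 2) = c ^ 2 := by
  rw [aspectRatio, div_pow, Real.sq_sqrt (by positivity)]
  field_simp

lemma aspectRatio_lt_one {A c : ℝ} (hA : 0 < A) (hc : 0 < c) : aspectRatio A c < 1 := by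
  rw [aspectRatio, div_lt_one (by positivity)]
  exact Real.lt_sqrt_of_sq_lt (by nlinarith)

lemma hasDerivAt_intervalMap (A k w : ℝ) :
    HasDerivAt (intervalMap A k) (A * k / √(1 + (k * w) ^ 2) ^ 3) w := by
  have hs : 0 < 1 + (k * w) ^ 2 := by positivity
  have h1 : HasDerivAt (fun w => k * w) k w := by simpa using (hasDerivAt_id w).const_mul k
  have h2 : HasDerivAt (fun w => 1 + (k * w) ^ 2) (2 * (k * w) * k) w := by
    simpa using (h1.pow 2).const_add 1
  have h3 := (h1.const_mul A).div (h2.sqrt hs.ne') (Real.sqrt_ne_zero'.2 hs)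
  have hq : √(1 + (k * w) ^ 2) ^ 2 = 1 + (k * w) ^ 2 := Real.sq_sqrt hs.le
  have hq0 : 0 < √(1 + (k * w) ^ 2) := Real.sqrt_pos.2 hs
  refine h3.congr_deriv ?_
  set s := √(1 + (k * w) ^ 2)
  field_simp
  linear_combination A * k * hq

lemma intervalMap_injective {A k : ℝ} (hA : 0 < A) (hk : 0 < k) :
    Function.Injective (intervalMap A k) := by
  refine (strictMono_of_hasDerivAt_pos (hasDerivAt_intervalMap A k) fun w => ?_).injective
  positivity

lemma intervalMap_sq (A k w : ℝ) :
    intervalMap A k w ^ 2 = A ^ 2 * (k * w) ^ 2 / (1 + (k * w) ^ 2) := by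
  rw [intervalMap, div_pow, Real.sq_sqrt (by positivity), mul_pow]

lemma range_intervalMap {A k : ℝ} (hA : 0 < A) (hk : 0 < k) :
    range (intervalMap A k) = Ioo (-A) A := by
  ext y
  rw [mem_Ioo, ← abs_lt, ← sq_lt_sq₀ (abs_nonneg y) hA.le, sq_abs]
  constructor
  · rintro ⟨w, rfl⟩
    rw [intervalMap_sq, div_lt_iff₀ (by positivity)]
    nlinarith [sq_pos_of_pos hA]
  · intro hy
    have h0 : 0 < A ^ 2 - y ^ 2 := by linarith
    have hs := Real.sqrt_pos.2 h0
    have hsq := Real.sq_sqrt h0.le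
    refine ⟨y / (k * √(A ^ 2 - y ^ 2)), ?_⟩
    set s := √(A ^ 2 - y ^ 2)
    have e1 : k * (y / (k * s)) = y / s := by field_simp
    have e2 : 1 + (y / s) ^ 2 = (A / s) ^ 2 := by
      field_simp
      linarith
    rw [intervalMap, e1, e2, Real.sqrt_sq (by positivity)]
    field_simp

lemma integral_balayageDensity {A c : ℝ} (hA : 0 < A) (hc : 0 < c) {g : ℝ → ℝ}
    (hg : Integrable fun w : ℝ => (1 + w ^ 2)⁻¹ * g (intervalMap A (aspectRatio A c) w)) :
    IntegrableOn (fun y => balayageDensity A c y * g y) (Ioo (-A) A) ∧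
      ∫ y in Ioo (-A) A, balayageDensity A c y * g y =
        Real.pi⁻¹ * ∫ w : ℝ, (1 + w ^ 2)⁻¹ * g (intervalMap A (aspectRatio A c) w) := by
  have hk := aspectRatio_pos (A := A) hc
  have hk2 := aspectRatio_sq (A := A) hc
  rw [← range_intervalMap hA hk]
  refine integral_cauchy_map (hasDerivAt_intervalMap A _) (intervalMap_injective hA hk)
    (fun w => ?_) hg
  rw [balayageDensity]
  set k := aspectRatio A c
  have hs : 0 < 1 + (k * w) ^ 2 := by positivity
  have hq : √(1 + (k * w) ^ 2) ^ 2 = 1 + (k * w) ^ 2 := Real.sq_sqrt hs.le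
  have hq0 : 0 < √(1 + (k * w) ^ 2) := Real.sqrt_pos.2 hs
  set s := √(1 + (k * w) ^ 2)
  have e1 : A ^ 2 - intervalMap A k w ^ 2 = (A / s) ^ 2 := by
    rw [intervalMap_sq, div_pow, hq]
    field_simp
    ring
  have e2 : intervalMap A k w ^ 2 + c ^ 2 = c ^ 2 * (1 + w ^ 2) / s ^ 2 := by
    rw [intervalMap_sq, hq]
    field_simp
    linear_combination w ^ 2 * hk2
  have := Real.pi_pos
  rw [e1, e2, Real.sqrt_sq (by positivity), abs_of_pos (by positivity)]
  field_simp
  linear_combination hk2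

lemma integral_balayageDensity_one {A c : ℝ} (hA : 0 < A) (hc : 0 < c) :
    IntegrableOn (balayageDensity A c) (Ioo (-A) A) ∧
      ∫ y in Ioo (-A) A, balayageDensity A c y = 1 := by
  have := integral_balayageDensity hA hc (g := fun _ => 1)
    (by simpa using integrable_inv_one_add_sq)
  simp only [mul_one, integral_univ_inv_one_add_sq] at this
  rwa [inv_mul_cancel₀ Real.pi_ne_zero] at this

/-- The coordinate `√(x² - A²) / |x| ∈ [0, 1)` of a point outside `[-A, A]`. It vanishes on
`[-A, A]`, where the square root of a negative number is `0`. -/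
def exteriorCoord (A x : ℝ) : ℝ := √(x ^ 2 - A ^ 2) / |x|

lemma exteriorCoord_nonneg (A x : ℝ) : 0 ≤ exteriorCoord A x := by
  unfold exteriorCoord
  positivity

lemma exteriorCoord_lt_one {A : ℝ} (hA : 0 < A) (x : ℝ) : exteriorCoord A x < 1 := by
  rcases eq_or_ne x 0 with rfl | hx
  · simp [exteriorCoord]
  · rw [exteriorCoord, div_lt_one (abs_pos.2 hx), Real.sqrt_lt' (abs_pos.2 hx), sq_abs]
    nlinarith

lemma exteriorCoord_eq_zero {A x : ℝ} (h : x ^ 2 ≤ A ^ 2) : exteriorCoord A x = 0 := by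
  rw [exteriorCoord, Real.sqrt_eq_zero_of_nonpos (by linarith), zero_div]

/-- The logarithmic integral behind the potential of the balayage. Inside `[-A, A]` the numerator of
`x² - y²` factors over the reals, outside it is a positive quadratic in `w`. -/
lemma integral_log_sq_sub_numerator {A k : ℝ} (hA : 0 < A) (hk : 0 < k) (hk1 : k < 1) (x : ℝ) :
    Integrable (fun w : ℝ => (1 + w ^ 2)⁻¹ *
        Real.log |x ^ 2 + (x ^ 2 - A ^ 2) * k ^ 2 * w ^ 2|) ∧
      ∫ w : ℝ, (1 + w ^ 2)⁻¹ * Real.log |x ^ 2 + (x ^ 2 - A ^ 2) * k ^ 2 * w ^ 2| =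
        Real.pi * (Real.log (x ^ 2 * (1 - k ^ 2) + k ^ 2 * A ^ 2) +
          Real.log ((1 + k * exteriorCoord A x) / (1 - k * exteriorCoord A x))) := by
  rcases lt_or_ge (x ^ 2) (A ^ 2) with h | h
  · have h0 : 0 < A ^ 2 - x ^ 2 := by linarith
    have hs := Real.sqrt_pos.2 h0
    have hsq := Real.sq_sqrt h0.le
    set q := k * √(A ^ 2 - x ^ 2) with hq
    have hq0 : 0 < q := by positivity
    have hq2 : q ^ 2 = k ^ 2 * (A ^ 2 - x ^ 2) := by rw [hq, mul_pow, hsq]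
    obtain ⟨i1, v1⟩ := integral_log_abs_sub_mul x hq0.ne'
    obtain ⟨i2, v2⟩ := integral_log_abs_sub_mul x (neg_ne_zero.2 hq0.ne')
    have hae : (fun w : ℝ => (1 + w ^ 2)⁻¹ * Real.log |x - q * w| +
        (1 + w ^ 2)⁻¹ * Real.log |x - -q * w|) =ᵐ[volume] fun w =>
        (1 + w ^ 2)⁻¹ * Real.log |x ^ 2 + (x ^ 2 - A ^ 2) * k ^ 2 * w ^ 2| := by
      have hne1 : ∀ᵐ w : ℝ, w ≠ x / q := by simp [ae_iff]
      have hne2 : ∀ᵐ w : ℝ, w ≠ x / -q := by simp [ae_iff]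
      filter_upwards [hne1, hne2] with w hw1 hw2
      have e1 : x - q * w ≠ 0 := fun h => hw1 (by field_simp; linarith)
      have e2 : x - -q * w ≠ 0 := fun h => hw2 (by field_simp; linarith)
      have e3 : x ^ 2 + (x ^ 2 - A ^ 2) * k ^ 2 * w ^ 2 = (x - q * w) * (x - -q * w) := by
        linear_combination w ^ 2 * hq2
      rw [e3, abs_mul, Real.log_mul (by positivity) (by positivity)]
      ring
    refine ⟨(i1.add i2).congr hae, ?_⟩
    rw [← integral_congr_ae hae, integral_add i1 i2, v1, v2, exteriorCoord_eq_zero h.le, neg_sq,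
      hq2]
    rw [mul_zero, add_zero, sub_zero, div_one, Real.log_one,
      show x ^ 2 + k ^ 2 * (A ^ 2 - x ^ 2) = x ^ 2 * (1 - k ^ 2) + k ^ 2 * A ^ 2 by ring]
    ring
  · have hx : 0 < |x| := by
      rw [abs_pos]
      rintro rfl
      nlinarith
    set u := exteriorCoord A x with hu
    have hu0 : 0 ≤ u := exteriorCoord_nonneg A x
    have hu1 : u < 1 := exteriorCoord_lt_one hA x
    have hku : k * u < 1 := by nlinarith
    have hxu : |x| ^ 2 * u ^ 2 = x ^ 2 - A ^ 2 := by
      rw [hu, exteriorCoord, div_pow, Real.sq_sqrt (by linarith)]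
      field_simp
    obtain ⟨i, v⟩ := integral_log_sq_add_sq (p := |x|) (q := |x| * (k * u)) hx.le (by positivity)
      (by positivity)
    have e : ∀ w : ℝ, |x| ^ 2 + (|x| * (k * u)) ^ 2 * w ^ 2 =
        |x ^ 2 + (x ^ 2 - A ^ 2) * k ^ 2 * w ^ 2| := by
      intro w
      have e0 : x ^ 2 + (x ^ 2 - A ^ 2) * k ^ 2 * w ^ 2 =
          |x| ^ 2 + (|x| * (k * u)) ^ 2 * w ^ 2 := by
        linear_combination -sq_abs x - k ^ 2 * w ^ 2 * hxu
      rw [e0]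
      exact (abs_of_nonneg (by positivity)).symm
    simp only [e] at i v
    refine ⟨i, v.trans ?_⟩
    have e2 : x ^ 2 * (1 - k ^ 2) + k ^ 2 * A ^ 2 = |x| ^ 2 * ((1 - k * u) * (1 + k * u)) := by
      linear_combination -sq_abs x + k ^ 2 * hxu
    have h1 : 0 < 1 - k * u := by linarith
    have h2 : 0 < 1 + k * u := by positivity
    rw [e2, Real.log_mul (by positivity) (by positivity), Real.log_mul h1.ne' h2.ne',
      Real.log_div h2.ne' h1.ne', Real.log_pow,
      show |x| + |x| * (k * u) = |x| * (1 + k * u) by ring, Real.log_mul hx.ne' h2.ne']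
    push_cast
    ring

/-- The symmetrized logarithmic potential of the balayage of a unit charge at `i c` onto
`[-A, A]`: up to a constant it agrees with that of the charge on `[-A, A]`, and the difference
outside is an inverse hyperbolic tangent of the exterior coordinate. -/
lemma integral_balayageDensity_log {A c : ℝ} (hA : 0 < A) (hc : 0 < c) (x : ℝ) :
    IntegrableOn (fun y => balayageDensity A c y * Real.log |x ^ 2 - y ^ 2|) (Ioo (-A) A) ∧
      ∫ y in Ioo (-A) A, balayageDensity A c y * Real.log |x ^ 2 - y ^ 2| =
        Real.log (x ^ 2 + c ^ 2) +
          Real.log ((1 - aspectRatio A c) / (1 + aspectRatio A c)) +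
          Real.log ((1 + aspectRatio A c * exteriorCoord A x) /
            (1 - aspectRatio A c * exteriorCoord A x)) := by
  have hk := aspectRatio_pos (A := A) hc
  have hk1 := aspectRatio_lt_one hA hc
  have hk2 := aspectRatio_sq (A := A) hc
  set k := aspectRatio A c with hkdef
  obtain ⟨i1, v1⟩ := integral_log_sq_sub_numerator hA hk hk1 x
  obtain ⟨i2, v2⟩ := integral_log_sq_add_sq (q := k) zero_le_one hk.le (by positivity)
  have hae : (fun w : ℝ => (1 + w ^ 2)⁻¹ * Real.log |x ^ 2 + (x ^ 2 - A ^ 2) * k ^ 2 * w ^ 2| -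
      (1 + w ^ 2)⁻¹ * Real.log (1 ^ 2 + k ^ 2 * w ^ 2)) =ᵐ[volume] fun w =>
      (1 + w ^ 2)⁻¹ * Real.log |x ^ 2 - intervalMap A k w ^ 2| := by
    have hinj := intervalMap_injective hA hk
    have hne (t : ℝ) : ∀ᵐ w : ℝ, intervalMap A k w ≠ t := by
      have : {w | intervalMap A k w = t}.Subsingleton := fun a ha b hb => hinj (ha.trans hb.symm)
      simpa [ae_iff] using this.measure_zero volume
    filter_upwards [hne x, hne (-x)] with w hw1 hw2
    have e1 : x ^ 2 - intervalMap A k w ^ 2 ≠ 0 := by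
      rw [sub_ne_zero]
      intro h
      rcases sq_eq_sq_iff_eq_or_eq_neg.1 h with h | h
      · exact hw1 h.symm
      · exact hw2 (by linarith)
    have e2 : x ^ 2 + (x ^ 2 - A ^ 2) * k ^ 2 * w ^ 2 =
        (x ^ 2 - intervalMap A k w ^ 2) * (1 ^ 2 + k ^ 2 * w ^ 2) := by
      rw [intervalMap_sq, ← mul_pow, one_pow]
      field_simp
      ring
    have h3 : 0 < 1 ^ 2 + k ^ 2 * w ^ 2 := by positivity
    rw [e2, abs_mul, abs_of_pos h3, Real.log_mul (by positivity) h3.ne']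
    ring
  have := integral_balayageDensity hA hc (g := fun y => Real.log |x ^ 2 - y ^ 2|)
    ((i1.sub i2).congr hae)
  refine ⟨this.1, this.2.trans ?_⟩
  have h1 : 0 < 1 - k := by linarith
  have h2 : 0 < 1 + k := by linarith
  have hc2 : x ^ 2 * (1 - k ^ 2) + k ^ 2 * A ^ 2 = (x ^ 2 + c ^ 2) * ((1 - k) * (1 + k)) := by
    linear_combination hk2
  rw [← hkdef, ← integral_congr_ae hae, integral_sub i1 i2, v1, v2, hc2,
    Real.log_mul (by positivity) (by positivity), Real.log_mul h1.ne' h2.ne',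
    Real.log_div h1.ne' h2.ne', ← mul_sub, inv_mul_cancel_left₀ Real.pi_ne_zero]
  ring

/-- Of two inverse hyperbolic tangents with the same slope at the origin, the one with the larger
dilation dominates, as is seen from the power series. -/
lemma mul_log_div_le_mul_log_div {m n k l u : ℝ} (hm : 0 ≤ m) (hk : 0 ≤ k) (hkl : k ≤ l)
    (hl : l < 1) (hmn : m * k = n * l) (hu : 0 ≤ u) (hu1 : u < 1) :
    m * Real.log ((1 + k * u) / (1 - k * u)) ≤ n * Real.log ((1 + l * u) / (1 - l * u)) := by
  have hl0 : 0 ≤ l := hk.trans hkl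
  have hku : 0 ≤ k * u := by positivity
  have hlu : 0 ≤ l * u := by positivity
  have hlu1 : l * u < 1 := by nlinarith
  have hkl' : k * u ≤ l * u := by gcongr
  have hku1 : k * u < 1 := hkl'.trans_lt hlu1
  rw [Real.log_div (by linarith) (by linarith), Real.log_div (by linarith) (by linarith)]
  refine hasSum_le (fun j => ?_)
    ((Real.hasSum_log_sub_log_of_abs_lt_one (by rwa [abs_of_nonneg hku])).mul_left m)
    ((Real.hasSum_log_sub_log_of_abs_lt_one (by rwa [abs_of_nonneg hlu])).mul_left n)
  have e1 : m * (2 * (1 / (2 * (j : ℝ) + 1)) * (k * u) ^ (2 * j + 1)) =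
      2 * (1 / (2 * (j : ℝ) + 1)) * ((m * k) * u * (k * u) ^ (2 * j)) := by ring
  have e2 : n * (2 * (1 / (2 * (j : ℝ) + 1)) * (l * u) ^ (2 * j + 1)) =
      2 * (1 / (2 * (j : ℝ) + 1)) * ((m * k) * u * (l * u) ^ (2 * j)) := by
    rw [hmn]
    ring
  rw [e1, e2]
  gcongr

/-! ### The supercritical case -/

/-- The common value of `(1 + a) k₁` and `a k₂`, where `k₁` and `k₂` are the aspect ratios
`c / √(A² + c²)` for `c = b⁻¹` and `c = b`. -/
def balanceConstant (a b : ℝ) : ℝ :=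
  √((b ^ 2 * a + a + 1) * (b ^ 2 * a - a - 1) / (b ^ 4 - 1))

lemma supercritical_pos {a b : ℝ} (ha : 0 < a) (hb : 1 < b) (h : 0 < b ^ 2 * a - a - 1) :
    0 < b ^ 4 - 1 ∧ 0 < (b ^ 2 * a + a + 1) * (b ^ 2 * a - a - 1) := by
  have hb4 : 1 < b ^ 4 := one_lt_pow₀ hb (by norm_num)
  exact ⟨by linarith, by positivity⟩

lemma endpointA_pos {a b : ℝ} (ha : 0 < a) (hb : 1 < b) (h : 0 < b ^ 2 * a - a - 1) :
    0 < endpointA a b := by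
  unfold endpointA
  positivity

lemma constantC_pos {a b : ℝ} (ha : 0 < a) (hb : 1 < b) (h : 0 < b ^ 2 * a - a - 1) :
    0 < constantC a b := by
  have := (supercritical_pos ha hb h).1
  unfold constantC
  positivity

lemma balanceConstant_pos {a b : ℝ} (ha : 0 < a) (hb : 1 < b) (h : 0 < b ^ 2 * a - a - 1) :
    0 < balanceConstant a b := by
  have := (supercritical_pos ha hb h).1
  unfold balanceConstant
  positivity

lemma balanceConstant_sq {a b : ℝ} (ha : 0 < a) (hb : 1 < b) (h : 0 < b ^ 2 * a - a - 1) :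
    balanceConstant a b ^ 2 =
      (b ^ 2 * a + a + 1) * (b ^ 2 * a - a - 1) / (b ^ 4 - 1) := by
  have := (supercritical_pos ha hb h).1
  exact Real.sq_sqrt (by positivity)

lemma endpointA_sq {a b : ℝ} (ha : 0 < a) (h : 0 < b ^ 2 * a - a - 1) :
    endpointA a b ^ 2 =
      b ^ 2 * (1 + 2 * a) / ((b ^ 2 * a + a + 1) * (b ^ 2 * a - a - 1)) := by
  rw [endpointA, div_pow, mul_pow, mul_pow, Real.sq_sqrt (by positivity),
    Real.sq_sqrt (by positivity), Real.sq_sqrt h.le]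

/-- The endpoint `A` is chosen so that the inverse square root singularities at `±A` of the two
balayage densities cancel. -/
lemma aspectRatio_balance {a b : ℝ} (ha : 0 < a) (hb : 1 < b) (h : 0 < b ^ 2 * a - a - 1) :
    (1 + a) * aspectRatio (endpointA a b) b⁻¹ = balanceConstant a b ∧
      a * aspectRatio (endpointA a b) b = balanceConstant a b := by
  have hb0 : 0 < b := by linarith
  obtain ⟨hb4, hD⟩ := supercritical_pos ha hb h
  have hS := balanceConstant_pos ha hb h
  have hS2 := balanceConstant_sq ha hb h
  have hA2 := endpointA_sq (b := b) ha h
  set S := balanceConstant a b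
  set A := endpointA a b
  set D := (b ^ 2 * a + a + 1) * (b ^ 2 * a - a - 1) with hDdef
  have e1 : √(A ^ 2 + (b⁻¹) ^ 2) = (1 + a) / (b * S) := by
    rw [← Real.sqrt_sq (show 0 ≤ (1 + a) / (b * S) by positivity), div_pow, mul_pow, hA2, hS2]
    congr 1
    field_simp
    rw [hDdef]
    ring
  have e2 : √(A ^ 2 + b ^ 2) = a * b / S := by
    rw [← Real.sqrt_sq (show 0 ≤ a * b / S by positivity), div_pow, hA2, hS2]
    congr 1
    field_simp
    rw [hDdef]
    ring
  rw [aspectRatio, aspectRatio, e1, e2]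
  constructor
  · field_simp
  · field_simp

lemma sqrt_constantC {a b : ℝ} (ha : 0 < a) (hb : 1 < b) (h : 0 < b ^ 2 * a - a - 1) :
    √(constantC a b) = balanceConstant a b * (b ^ 4 - 1) / b ^ 2 := by
  have hb0 : 0 < b := by linarith
  have hb4 := (supercritical_pos ha hb h).1
  have hS := balanceConstant_pos ha hb h
  rw [← Real.sqrt_sq (show 0 ≤ balanceConstant a b * (b ^ 4 - 1) / b ^ 2 by positivity), div_pow,
    mul_pow, balanceConstant_sq ha hb h, constantC]
  congr 1
  field_simp

lemma supercriticalDensity_eq {a b : ℝ} (ha : 0 < a) (hb : 1 < b) (h : 0 < b ^ 2 * a - a - 1)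
    {y : ℝ} (hy : y ∈ Ioo (-endpointA a b) (endpointA a b)) : supercriticalDensity a b y =
      (1 + a) * balayageDensity (endpointA a b) b⁻¹ y -
        a * balayageDensity (endpointA a b) b y := by
  have hb0 : 0 < b := by linarith
  obtain ⟨h1, h2⟩ := aspectRatio_balance ha hb h
  have hC := sqrt_constantC ha hb h
  rw [supercriticalDensity, balayageDensity, balayageDensity, ← mul_div_assoc, ← mul_assoc, h1,
    ← mul_div_assoc, ← mul_assoc, h2, hC]
  set S := balanceConstant a b
  set A := endpointA a b
  have h0 : 0 < A ^ 2 - y ^ 2 := by nlinarith [hy.1, hy.2]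
  have hs := Real.sqrt_pos.2 h0
  have hsq := Real.sq_sqrt h0.le
  set s := √(A ^ 2 - y ^ 2)
  have := Real.pi_pos
  have h3 : 0 < y ^ 2 + b ^ 2 := by positivity
  have h4 : 0 < y ^ 2 * b ^ 2 + 1 := by positivity
  rw [inv_pow]
  field_simp
  rw [hsq]
  ring

lemma supercriticalDensity_nonneg (a b x : ℝ) : 0 ≤ supercriticalDensity a b x := by
  have := Real.pi_pos
  unfold supercriticalDensity
  positivity

lemma supercriticalDensity_ne_zero_iff {a b : ℝ} (ha : 0 < a) (hb : 1 < b)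
    (h : 0 < b ^ 2 * a - a - 1) (x : ℝ) :
    supercriticalDensity a b x ≠ 0 ↔ x ∈ Ioo (-endpointA a b) (endpointA a b) := by
  have hA := endpointA_pos ha hb h
  have hC := Real.sqrt_pos.2 (constantC_pos ha hb h)
  have := Real.pi_pos
  have h1 : Real.pi * (x ^ 2 + b ^ 2) * (x ^ 2 + (b ^ 2)⁻¹) ≠ 0 := by positivity
  have h2 : √(endpointA a b ^ 2 - x ^ 2) ≠ 0 ↔ x ∈ Ioo (-endpointA a b) (endpointA a b) := by
    rw [Real.sqrt_ne_zero', sub_pos, mem_Ioo, ← abs_lt, sq_lt_sq, abs_of_pos hA]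
  rw [supercriticalDensity, div_ne_zero_iff, mul_ne_zero_iff, h2]
  exact ⟨fun h => h.1.2, fun h => ⟨⟨hC.ne', h⟩, h1⟩⟩

lemma continuous_supercriticalDensity (a : ℝ) {b : ℝ} (hb : 0 < b) :
    Continuous (supercriticalDensity a b) := by
  unfold supercriticalDensity
  refine Continuous.div (by fun_prop) (by fun_prop) fun x => ?_
  have := Real.pi_pos
  positivity

lemma continuous_subcriticalDensity (a : ℝ) {b : ℝ} (hb : 0 < b) :
    Continuous (subcriticalDensity a b) := by
  unfold subcriticalDensity
  refine Continuous.div (by fun_prop) (by fun_prop) fun x => ?_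
  have := Real.pi_pos
  positivity

lemma supercriticalDensity_le {a b : ℝ} (ha : 0 < a) (hb : 1 < b) (h : 0 < b ^ 2 * a - a - 1)
    (y : ℝ) : supercriticalDensity a b y ≤
      √(constantC a b) * endpointA a b * b ^ 2 / Real.pi * (1 + y ^ 2)⁻¹ := by
  have hA := endpointA_pos ha hb h
  have := Real.pi_pos
  have hb0 : 0 < b := by linarith
  have h1 : √(endpointA a b ^ 2 - y ^ 2) ≤ endpointA a b :=
    Real.sqrt_le_iff.2 ⟨hA.le, by nlinarith [sq_nonneg y]⟩
  have h2 : 1 ≤ b ^ 2 := one_le_pow₀ hb.le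
  have h3 : Real.pi * (1 + y ^ 2) * (b ^ 2)⁻¹ ≤
      Real.pi * (y ^ 2 + b ^ 2) * (y ^ 2 + (b ^ 2)⁻¹) := by
    have : (b ^ 2)⁻¹ ≤ y ^ 2 + (b ^ 2)⁻¹ := by nlinarith [sq_nonneg y]
    have : 1 + y ^ 2 ≤ y ^ 2 + b ^ 2 := by linarith
    gcongr
  calc supercriticalDensity a b y
      ≤ √(constantC a b) * endpointA a b / (Real.pi * (1 + y ^ 2) * (b ^ 2)⁻¹) := by
        unfold supercriticalDensity
        gcongr
    _ = _ := by field_simp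

/-- Integrals against the supercritical density are integrals against the sweeping of the charges
`1 + a` and `-a` onto `[-A, A]`. -/
lemma integral_supercriticalDensity_mul {a b : ℝ} (ha : 0 < a) (hb : 1 < b)
    (h : 0 < b ^ 2 * a - a - 1) {g : ℝ → ℝ}
    (i1 : IntegrableOn (fun y => balayageDensity (endpointA a b) b⁻¹ y * g y)
      (Ioo (-endpointA a b) (endpointA a b)))
    (i2 : IntegrableOn (fun y => balayageDensity (endpointA a b) b y * g y)
      (Ioo (-endpointA a b) (endpointA a b))) :
    ∫ y, supercriticalDensity a b y * g y =
      (1 + a) * (∫ y in Ioo (-endpointA a b) (endpointA a b),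
        balayageDensity (endpointA a b) b⁻¹ y * g y) -
      a * ∫ y in Ioo (-endpointA a b) (endpointA a b),
        balayageDensity (endpointA a b) b y * g y := by
  rw [← integral_const_mul, ← integral_const_mul, ← integral_sub (i1.const_mul _) (i2.const_mul _),
    ← setIntegral_eq_integral_of_forall_compl_eq_zero (s := Ioo (-endpointA a b) (endpointA a b))]
  · refine setIntegral_congr_fun measurableSet_Ioo fun y hy => ?_
    simp only [supercriticalDensity_eq ha hb h hy]
    ring
  · intro y hy
    have : supercriticalDensity a b y = 0 := by
      by_contra h0
      exact hy ((supercriticalDensity_ne_zero_iff ha hb h y).1 h0)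
    rw [this, zero_mul]

/-- As the density is even, its logarithmic potential is half the integral of `log |x² - y²|`. -/
lemma integral_supercriticalDensity_log {a b : ℝ} (ha : 0 < a) (hb : 1 < b)
    (h : 0 < b ^ 2 * a - a - 1) (x : ℝ) : ∫ y, supercriticalDensity a b y * Real.log |x - y| =
      1 / 2 * ∫ y, supercriticalDensity a b y * Real.log |x ^ 2 - y ^ 2| := by
  have hb0 : 0 < b := by linarith
  have i1 : Integrable (fun y => supercriticalDensity a b y * Real.log |x - y|) :=
    integrable_mul_of_le_cauchy (g := fun y => Real.log |x - y|)
      (continuous_supercriticalDensity a hb0).measurable (supercriticalDensity_nonneg a b)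
      (supercriticalDensity_le ha hb h) (by fun_prop) (integral_log_abs_sub x).1
  have e : (fun y => supercriticalDensity a b (-y) * Real.log |x - -y|) =
      fun y => supercriticalDensity a b y * Real.log |x + y| := by
    funext y
    rw [sub_neg_eq_add, supercriticalDensity, supercriticalDensity, neg_sq]
  have i2 : Integrable (fun y => supercriticalDensity a b y * Real.log |x + y|) := e ▸ i1.comp_neg
  have v2 : ∫ y, supercriticalDensity a b y * Real.log |x + y| =
      ∫ y, supercriticalDensity a b y * Real.log |x - y| := by
    rw [← e]
    exact integral_neg_eq_self (fun y => supercriticalDensity a b y * Real.log |x - y|) volume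
  have hae : (fun y => supercriticalDensity a b y * Real.log |x ^ 2 - y ^ 2|) =ᵐ[volume] fun y =>
      supercriticalDensity a b y * Real.log |x - y| +
        supercriticalDensity a b y * Real.log |x + y| := by
    have hne (t : ℝ) : ∀ᵐ y : ℝ, y ≠ t := by simp [ae_iff]
    filter_upwards [hne x, hne (-x)] with y h1 h2
    have e1 : x - y ≠ 0 := fun h => h1 (by linarith)
    have e2 : x + y ≠ 0 := fun h => h2 (by linarith)
    rw [show x ^ 2 - y ^ 2 = (x - y) * (x + y) by ring, abs_mul,
      Real.log_mul (by positivity) (by positivity)]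
    ring
  rw [integral_congr_ae hae, integral_add i1 i2, v2]
  ring

/-- Above the critical charge the sweeping of the charges `1 + a` and `-a` onto `[-A, A]` is a
positive measure; its potential cancels the field up to a constant on `[-A, A]`, and the excess
outside is a difference of inverse hyperbolic tangents, which is nonnegative. -/
theorem isEquilibriumMeasure_supercritical {a b : ℝ} (ha : 0 < a) (hb : 1 < b)
    (h : 0 < b ^ 2 * a - a - 1) : IsEquilibriumMeasure (field a b)
      (volume.withDensity fun x => ENNReal.ofReal (supercriticalDensity a b x)) := by
  have hb0 : 0 < b := by linarith
  have hb1 : 0 < b⁻¹ := by positivity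
  have hA := endpointA_pos ha hb h
  obtain ⟨bal1, bal2⟩ := aspectRatio_balance ha hb h
  have hk1 := aspectRatio_pos (A := endpointA a b) hb1
  have hk2 := aspectRatio_lt_one hA hb0
  have hk : aspectRatio (endpointA a b) b⁻¹ ≤ aspectRatio (endpointA a b) b := by
    nlinarith
  have hpot (x : ℝ) : field a b x - ∫ y, supercriticalDensity a b y * Real.log |x - y| =
      -(1 / 2) * ((1 + a) * Real.log ((1 - aspectRatio (endpointA a b) b⁻¹) /
          (1 + aspectRatio (endpointA a b) b⁻¹)) -
        a * Real.log ((1 - aspectRatio (endpointA a b) b) / (1 + aspectRatio (endpointA a b) b))) +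
      1 / 2 * (a * Real.log ((1 + aspectRatio (endpointA a b) b * exteriorCoord (endpointA a b) x) /
          (1 - aspectRatio (endpointA a b) b * exteriorCoord (endpointA a b) x)) -
        (1 + a) * Real.log
          ((1 + aspectRatio (endpointA a b) b⁻¹ * exteriorCoord (endpointA a b) x) /
          (1 - aspectRatio (endpointA a b) b⁻¹ * exteriorCoord (endpointA a b) x))) := by
    obtain ⟨i1, v1⟩ := integral_balayageDensity_log hA hb1 x
    obtain ⟨i2, v2⟩ := integral_balayageDensity_log hA hb0 x
    rw [integral_supercriticalDensity_log ha hb h,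
      integral_supercriticalDensity_mul (g := fun y => Real.log |x ^ 2 - y ^ 2|) ha hb h i1 i2,
      v1, v2, field, inv_pow]
    ring
  refine isEquilibriumMeasure_withDensity (field_eq a b) (measurable_fieldRemainder a b)
    (abs_fieldRemainder_le ha hb0) (continuous_supercriticalDensity a hb0).measurable
    (supercriticalDensity_nonneg a b) (supercriticalDensity_le ha hb h) ?_
    (F := -(1 / 2) * ((1 + a) * Real.log ((1 - aspectRatio (endpointA a b) b⁻¹) /
          (1 + aspectRatio (endpointA a b) b⁻¹)) -
        a * Real.log ((1 - aspectRatio (endpointA a b) b) / (1 + aspectRatio (endpointA a b) b))))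
    (fun x => ?_) (fun x hx => ?_)
  · obtain ⟨i1, v1⟩ := integral_balayageDensity_one hA hb1
    obtain ⟨i2, v2⟩ := integral_balayageDensity_one hA hb0
    have := integral_supercriticalDensity_mul ha hb h (g := fun _ => 1)
      (by simpa only [mul_one] using i1) (by simpa only [mul_one] using i2)
    simp only [mul_one] at this
    rw [this, v1, v2]
    ring
  · rw [hpot]
    have := mul_log_div_le_mul_log_div (show 0 ≤ 1 + a by linarith) hk1.le hk hk2
      (bal1.trans bal2.symm) (exteriorCoord_nonneg (endpointA a b) x) (exteriorCoord_lt_one hA x)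
    linarith
  · rw [hpot, exteriorCoord_eq_zero]
    · simp
    · have := (supercriticalDensity_ne_zero_iff ha hb h x).1 hx
      nlinarith [this.1, this.2]

lemma le_criticalCharge_iff {a b : ℝ} (hb : 1 ≤ b) :
    (a : EReal) ≤ criticalCharge b ↔ b ^ 2 * a - a - 1 ≤ 0 := by
  rcases hb.eq_or_lt with rfl | hb
  · simp [criticalCharge]
  · have h1 : 0 < b ^ 2 - 1 := by nlinarith
    rw [criticalCharge, if_neg hb.ne', EReal.coe_le_coe_iff, ← one_div, le_div_iff₀ h1]
    constructor <;> intro h <;> linarith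

lemma subcriticalDensity_pos {a b : ℝ} (ha : 0 < a) (hb : 1 ≤ b) (h : b ^ 2 * a - a - 1 ≤ 0)
    (x : ℝ) : 0 < subcriticalDensity a b x := by
  have hb0 : 0 < b := by linarith
  have := Real.pi_pos
  have h1 : 0 ≤ (1 + a - b ^ 2 * a) * x ^ 2 := mul_nonneg (by linarith) (sq_nonneg x)
  have h2 : 1 ≤ b ^ 2 := one_le_pow₀ hb
  have h3 : 0 < (1 + a - b ^ 2 * a) * x ^ 2 + b ^ 2 + b ^ 2 * a - a := by nlinarith
  unfold subcriticalDensity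
  positivity

end TwoCharges

end

theorem theorem1p4 (a b : ℝ) (ha : 0 < a) (hb : 1 ≤ b) :
    TwoCharges.IsWeaklyAdmissible (TwoCharges.field a b) ∧
    ∃ μV : Measure ℝ, TwoCharges.IsEquilibriumMeasure (TwoCharges.field a b) μV ∧
      ((a : EReal) ≤ TwoCharges.criticalCharge b →
        μV.support = univ ∧
        (∀ x : ℝ, 0 ≤ TwoCharges.subcriticalDensity a b x) ∧
        μV = volume.withDensity
          (fun x => ENNReal.ofReal (TwoCharges.subcriticalDensity a b x))) ∧
      (TwoCharges.criticalCharge b < (a : EReal) →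
        0 < TwoCharges.endpointA a b ∧
        0 < TwoCharges.constantC a b ∧
        μV.support = Icc (-TwoCharges.endpointA a b) (TwoCharges.endpointA a b) ∧
        μV = (volume.restrict
          (Icc (-TwoCharges.endpointA a b) (TwoCharges.endpointA a b))).withDensity
            (fun x => ENNReal.ofReal (TwoCharges.supercriticalDensity a b x))) := by
  have hb0 : 0 < b := by linarith
  refine ⟨TwoCharges.isWeaklyAdmissible_field a hb0, ?_⟩
  rw [← not_le, TwoCharges.le_criticalCharge_iff hb]
  rcases le_or_gt (b ^ 2 * a - a - 1) 0 with h | h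
  · have hpos := TwoCharges.subcriticalDensity_pos ha hb h
    refine ⟨_, TwoCharges.isEquilibriumMeasure_subcritical ha hb fun x => (hpos x).le,
      fun _ => ⟨?_, fun x => (hpos x).le, rfl⟩, fun hn => absurd h hn⟩
    rw [TwoCharges.support_withDensity_of_continuous
      (TwoCharges.continuous_subcriticalDensity a hb0) fun x => (hpos x).le, tsupport,
      Function.support_eq_univ fun x => (hpos x).ne', closure_univ]
  · have hb' : 1 < b := by
      refine lt_of_le_of_ne hb ?_
      rintro rfl
      linarith
    have hA := TwoCharges.endpointA_pos ha hb' h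
    have hne := TwoCharges.supercriticalDensity_ne_zero_iff ha hb' h
    refine ⟨_, TwoCharges.isEquilibriumMeasure_supercritical ha hb' h,
      fun hle => absurd hle (not_le.2 h), fun _ => ⟨hA, TwoCharges.constantC_pos ha hb' h, ?_, ?_⟩⟩
    · rw [TwoCharges.support_withDensity_of_continuous
        (TwoCharges.continuous_supercriticalDensity a hb0)
        (TwoCharges.supercriticalDensity_nonneg a b), tsupport,
        show Function.support (TwoCharges.supercriticalDensity a b) =
          Ioo (-TwoCharges.endpointA a b) (TwoCharges.endpointA a b) from Set.ext hne,
        closure_Ioo (by linarith)]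
    · rw [← withDensity_indicator measurableSet_Icc]
      congr 1
      funext x
      by_cases hx : x ∈ Icc (-TwoCharges.endpointA a b) (TwoCharges.endpointA a b)
      · rw [indicator_of_mem hx]
      · rw [indicator_of_notMem hx, ENNReal.ofReal_eq_zero]
        by_contra h0
        exact hx (Ioo_subset_Icc_self ((hne x).1 fun h1 => h0 h1.le))
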